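/- Words over a finite alphabet $X$, $|X|\ge 2$, form the set $X^*$. A group $G$ with a faithful, length-preserving action on $X^*$ is a \emph{self-similar group} over $X$ if for all $g\in G$, $x\in X$ there is $g|_x\in G$ with $g(xw)=g(x)\,g|_x(w)$ for all $w\in X^*$; put $g|_{xv}=(g|_x)|_v$. It is \emph{contracting} if there is a finite set $N\subseteq G$, closed under $g\mapsto g|_x$, such that for each $g\in G$ there is $m\ge 0$ with $g|_w\in N$ for all words $w$ of length $m$. It is \emph{self-replicating} if it is transitive on the words of each length and, for each $x\in X$, the map $g\mapsto g|_x$ from the stabilizer of $x$ to $G$ is surjective. For a field $K$, the \emph{Nekrashevych algebra} $\mathcal N_K(G,X)$ is the unital $K$-$*$-algebra (with $K$-linear involution) generated by $X\cup G$ subject to: the product and identity of $G$ are those of the algebra and $g^*=g^{-1}$ for $g\in G$; $gx=g(x)\,g|_x$ for $g\in G$, $x\in X$; $y^*x=\delta_{x,y}$ for $x,y\in X$; and $\sum_{x\in X}xx^*=1$. For an integer $n>2$ let $\mathfrak G_n$ be the following group of permutations of $X^*$, where $X=\mathbb Z_n=\mathbb Z/n\mathbb Z$. Let $G=\mathbb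 Z_n^2$ (column vectors), let $H=\mathbb Z_n$ act on $X=\mathbb Z_n$ by translations, and let \[ \Phi(0)=\begin{pmatrix}1&1\\0&1\end{pmatrix},\quad \Phi(1)=\begin{pmatrix}1&0\\1&1\end{pmatrix},\quad \Phi(n-1)=\begin{pmatrix}0&1\end{pmatrix},\quad \Phi(k)=\begin{pmatrix}0&0\end{pmatrix}\ (1<k<n-1), \] regarded as automorphisms of $G$ (for $k=0,1$) and homomorphisms $G\to H$ (for the other $k$). Each $h\in H$ acts on $X^*$ by $h(xw)=(h+x)w$, and each $g\in G$ acts recursively by $g(xw)=x\,(\Phi(x)(g))(w)$. The \emph{multispinal group} $\mathfrak G_n$ is the group generated by these permutations; it is self-similar over $\mathbb Z_n$. \textbf{Theorem.} Let $n>2$ be an integer and let $K$ be a field of characteristic $p\geq 0$. Then $\mathcal N_K(\mathfrak G_n,\mathbb Z_n)$ is simple if and only if $p$ does not divide $n$. Moreover, for every finite set $\mathcal P$ of primes there is a contracting, self-replicating, self-similar group $G$ over a finite alphabet $X$ with $|X|\geq 2$ such that, for every field $K$, the algebra $\mathcal N_K(G,X)$ is simple if and only if the characteristic of $K$ does not belong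 to $\mathcal P$. -/

import Mathlib

universe u

/-! ### Self-similar groups

Words over the alphabet `X` are lists; the first letter of a word is the head of the list. -/

/-- A group `G` acting on the set of words `X*` is *self-similar* over `X` if the action is faithful
and length-preserving and if, for all `g ∈ G` and `x ∈ X`, there is an element `h = g|ₓ` of `G` with
`g(xw) = g(x) h(w)` for all words `w`. -/
class IsSelfSimilar (G X : Type*) [Group G] [MulAction G (List X)] : Prop
    extends FaithfulSMul G (List X) where
  length_smul : ∀ (g : G) (w : List X), (g • w).length = w.length
  exists_section : ∀ (g : G) (x : X), ∃ h : G, ∀ w : List X, g • (x :: w) = g • [x] ++ h • w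

section SelfSimilar

variable {G X : Type*} [Group G] [MulAction G (List X)] [IsSelfSimilar G X]

/-- The letter `g(x)`. -/
def letterAct (g : G) (x : X) : X :=
  (g • [x]).head (List.ne_nil_of_length_pos (by rw [IsSelfSimilar.length_smul]; simp))

/-- The section `g|ₓ` at a letter (it is unique because the action is faithful). -/
noncomputable def letterSection (g : G) (x : X) : G :=
  Classical.choose (IsSelfSimilar.exists_section g x)

/-- The section `g|_w` at a word, `g|_{xv} = (g|ₓ)|_v`. -/
noncomputable def wordSection (g : G) : List X → G
  | [] => g
  | x :: v => wordSection (letterSection g x) v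

end SelfSimilar

/-- `G` is *contracting* if there is a finite subset `N` of `G`, closed under taking sections, such
that for each `g ∈ G` all sections of `g` at the words of some length `n` lie in `N`. -/
def IsContracting (G X : Type*) [Group G] [MulAction G (List X)] [IsSelfSimilar G X] : Prop :=
  ∃ N : Set G, N.Finite ∧ (∀ a ∈ N, ∀ x : X, letterSection a x ∈ N) ∧
    ∀ g : G, ∃ n : ℕ, ∀ w : List X, w.length = n → wordSection g w ∈ N

/-- `G` is *self-replicating* if it is transitive on the words of each length and if, for every
letter `x`, the map `g ↦ g|ₓ` from the stabilizer of `x` to `G` is surjective. -/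
def IsSelfReplicating (G X : Type*) [Group G] [MulAction G (List X)] [IsSelfSimilar G X] : Prop :=
  (∀ u v : List X, u.length = v.length → ∃ g : G, g • u = v) ∧
    ∀ (x : X) (h : G), ∃ g : G, g • [x] = [x] ∧ letterSection g x = h

/-! ### Nekrashevych algebras -/

/-- Algebra generators of the Nekrashevych algebra: the letters `x`, their adjoints `x*`, and the
elements `g` of the group (whose adjoint `g*` is the generator `g⁻¹`). -/
inductive NekGen (G X : Type*) where
  | letter (x : X)
  | star (x : X)
  | grp (g : G)

section Nekrashevych

variable (K G X : Type*) [Field K] [Group G] [Fintype X] [MulAction G (List X)] [IsSelfSimilar G X]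

/-- The defining relations. The set of relations is stable under the involution
given by `x ↔ x*` and `g ↔ g⁻¹`, so the algebra with these relations is the `*`-algebra generated
by `X ∪ G` with the relations `g* = g⁻¹`, `g · h = gh`, `1_G = 1`, `g x = g(x) g|ₓ`,
`y* x = δ_{x,y}`, `∑ₓ x x* = 1`. -/
inductive NekRel : FreeAlgebra K (NekGen G X) → FreeAlgebra K (NekGen G X) → Prop
  | one : NekRel (FreeAlgebra.ι K (.grp 1)) 1
  | mul (g h : G) :
      NekRel (FreeAlgebra.ι K (.grp g) * FreeAlgebra.ι K (.grp h)) (FreeAlgebra.ι K (.grp (g * h)))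
  | ss (g : G) (x : X) :
      NekRel (FreeAlgebra.ι K (.grp g) * FreeAlgebra.ι K (.letter x))
        (FreeAlgebra.ι K (.letter (letterAct g x)) * FreeAlgebra.ι K (.grp (letterSection g x)))
  | ss_star (g : G) (x : X) :
      NekRel (FreeAlgebra.ι K (.star x) * FreeAlgebra.ι K (.grp g⁻¹))
        (FreeAlgebra.ι K (.grp (letterSection g x)⁻¹) * FreeAlgebra.ι K (.star (letterAct g x)))
  | ck1_same (x : X) :
      NekRel (FreeAlgebra.ι K (.star x) * FreeAlgebra.ι K (.letter x)) 1
  | ck1_ne (x y : X) (hxy : x ≠ y) :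
      NekRel (FreeAlgebra.ι K (.star y) * FreeAlgebra.ι K (.letter x)) 0
  | ck2 :
      NekRel (∑ x : X, FreeAlgebra.ι K (.letter x) * FreeAlgebra.ι K (.star x)) 1

/-- The Nekrashevych algebra of the self-similar group `G` over the alphabet `X` with coefficients
in `K`. -/
abbrev NekrashevychAlgebra : Type _ := RingQuot (NekRel K G X)

end Nekrashevych

/-! ### Automaton groups -/

/-- An invertible automaton with state set `Q`: in state `q` it reads a letter `x`, writes
`out q x`, and moves to the state `next q x`, the section of `q` at `x`. -/
structure MealyAutomaton (Q X : Type*) where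
  out : Q → Equiv.Perm X
  next : Q → X → Q

namespace MealyAutomaton

variable {Q X : Type*} (M : MealyAutomaton Q X)

/-- The map on words computed from the state `q`. -/
def run : Q → List X → List X
  | _, [] => []
  | q, x :: w => M.out q x :: run (M.next q x) w

/-- The inverse of the map computed from the state `q`. -/
def runInv : Q → List X → List X
  | _, [] => []
  | q, y :: w => (M.out q).symm y :: runInv (M.next q ((M.out q).symm y)) w

theorem runInv_run (q : Q) (w : List X) : M.runInv q (M.run q w) = w := by
  induction w generalizing q with
  | nil => rfl
  | cons x w ih => simp [run, runInv, ih]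

theorem run_runInv (q : Q) (w : List X) : M.run q (M.runInv q w) = w := by
  induction w generalizing q with
  | nil => rfl
  | cons x w ih => simp [run, runInv, ih]

/-- The permutation of `X*` given by the state `q`. -/
def statePerm (q : Q) : Equiv.Perm (List X) where
  toFun := M.run q
  invFun := M.runInv q
  left_inv := M.runInv_run q
  right_inv := M.run_runInv q

/-- The group generated by the states of the automaton. -/
def automatonGroup : Subgroup (Equiv.Perm (List X)) :=
  Subgroup.closure (Set.range M.statePerm)

theorem length_apply_of_mem {g : Equiv.Perm (List X)} (hg : g ∈ M.automatonGroup) :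
    ∀ w : List X, (g w).length = w.length := by
  have hrun : ∀ (q : Q) (w : List X), (M.run q w).length = w.length := by
    intro q w
    induction w generalizing q with
    | nil => rfl
    | cons x w ih => simp [run, ih]
  induction hg using Subgroup.closure_induction with
  | mem g hg =>
    obtain ⟨q, rfl⟩ := hg
    exact hrun q
  | one => intro w; rfl
  | mul a b _ _ ha hb => intro w; rw [Equiv.Perm.mul_apply, ha, hb]
  | inv a _ ha => intro w; rw [← ha (a⁻¹ w), Equiv.Perm.inv_def, Equiv.apply_symm_apply]

theorem exists_section_of_mem {g : Equiv.Perm (List X)} (hg : g ∈ M.automatonGroup) :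
    ∀ x : X, ∃ y : X, ∃ h ∈ M.automatonGroup, ∀ w : List X, g (x :: w) = y :: h w := by
  induction hg using Subgroup.closure_induction with
  | mem g hg =>
    obtain ⟨q, rfl⟩ := hg
    exact fun x => ⟨M.out q x, M.statePerm (M.next q x),
      Subgroup.subset_closure ⟨_, rfl⟩, fun w => rfl⟩
  | one => exact fun x => ⟨x, 1, one_mem _, fun w => rfl⟩
  | mul a b _ _ ha hb =>
    intro x
    obtain ⟨y, h, hh, hy⟩ := hb x
    obtain ⟨z, k, hk, hz⟩ := ha y
    exact ⟨z, k * h, mul_mem hk hh, fun w => by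
      rw [Equiv.Perm.mul_apply, hy, hz, Equiv.Perm.mul_apply]⟩
  | inv a ha' ha =>
    intro x
    have hl := M.length_apply_of_mem (inv_mem ha') [x]
    obtain ⟨y, hy⟩ := List.length_eq_one_iff.mp hl
    obtain ⟨z, k, hk, hz⟩ := ha y
    have hax : a [y] = [x] := by rw [← hy, Equiv.Perm.inv_def, Equiv.apply_symm_apply]
    have hzx : z = x := by
      have := (hz []).symm.trans hax
      simp_all
    refine ⟨y, k⁻¹, inv_mem hk, fun w => ?_⟩
    rw [Equiv.Perm.inv_eq_iff_eq, hz, Equiv.Perm.inv_def, Equiv.apply_symm_apply, hzx]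

instance isSelfSimilar : IsSelfSimilar M.automatonGroup X where
  length_smul g w := M.length_apply_of_mem g.2 w
  exists_section g x := by
    obtain ⟨y, h, hh, hy⟩ := M.exists_section_of_mem g.2 x
    refine ⟨⟨h, hh⟩, fun w => ?_⟩
    have h0 : h [] = [] := List.length_eq_zero_iff.mp (M.length_apply_of_mem hh [])
    change (g : Equiv.Perm (List X)) (x :: w) = (g : Equiv.Perm (List X)) [x] ++ h w
    rw [hy, hy, h0]
    rfl

end MealyAutomaton

/-! ### Multispinal groups -/

/-- The data of a multispinal group over the finite alphabet `X`: finite groups `G` and `H`, where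
`H` acts freely on `X`, and a map `Φ` from `X` to the disjoint union of `Aut(G)` and `Hom(G, H)`
with the properties (S1), (S2), (S3). In (S3) the group `A` is generated by the automorphisms among
the `Φ(x)`, the set `B` consists of the `μ ∘ α` with `α ∈ A` and `μ` a homomorphism among
the `Φ(x)`, and the kernels of the elements of `B` intersect trivially. -/
structure MultispinalData (X G H : Type*) [Finite X] [Group G] [Finite G] [Group H] [Finite H]
    [MulAction H X] where
  Φ : X → MulAut G ⊕ (G →* H)
  free : ∀ (h : H) (x : X), h • x = x → h = 1
  s1 : ∃ (x : X) (α : MulAut G), Φ x = .inl α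
  s2 : ∃ (x : X) (μ : G →* H), Φ x = .inr μ
  s3 : ∀ g : G,
    (∀ (x : X) (μ : G →* H), Φ x = .inr μ →
      ∀ α ∈ Subgroup.closure {β : MulAut G | ∃ y : X, Φ y = .inl β}, μ (α g) = 1) → g = 1

namespace MultispinalData

variable {X G H : Type*} [Finite X] [Group G] [Finite G] [Group H] [Finite H] [MulAction H X]

/-- The automaton of a multispinal group. A state `h ∈ H` acts on the first letter and has trivial
sections; a state `g ∈ G` fixes all letters and has the section `Φ(x)(g)` at `x`. The states `1_G`
and `1_H` both give the identity map of `X*`, so identifying them does not change the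
group generated by the states. -/
def automaton (D : MultispinalData X G H) : MealyAutomaton (G ⊕ H) X where
  out
    | .inl _ => 1
    | .inr h => MulAction.toPerm h
  next
    | .inl g, x => match D.Φ x with
      | .inl α => .inl (α g)
      | .inr μ => .inr (μ g)
    | .inr _, _ => .inr 1

/-- The multispinal group, generated by the states of the automaton. -/
abbrev group (D : MultispinalData X G H) : Subgroup (Equiv.Perm (List X)) :=
  D.automaton.automatonGroup

end MultispinalData

/-! ### The groups `𝔊ₙ` -/

/-- The automorphism `v ↦ M v` of the group of column vectors `(ℤ/n)²`, for `M ∈ SL₂(ℤ/n)`. -/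
def matAut {n : ℕ} (M : Matrix.SpecialLinearGroup (Fin 2) (ZMod n)) :
    MulAut (Multiplicative (Fin 2 → ZMod n)) :=
  AddEquiv.toMultiplicative (Matrix.SpecialLinearGroup.toLin' M).toAddEquiv

/-- The homomorphism `v ↦ r v` from `(ℤ/n)²` to `ℤ/n`, for a row vector `r`. -/
def rowHom {n : ℕ} (r : Fin 2 → ZMod n) :
    Multiplicative (Fin 2 → ZMod n) →* Multiplicative (ZMod n) :=
  AddMonoidHom.toMultiplicative
    { toFun := fun v => r ⬝ᵥ v
      map_zero' := dotProduct_zero r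
      map_add' := dotProduct_add r }

/-- `Φ(0) = (1 1; 0 1)`, `Φ(1) = (1 0; 1 1)`, `Φ(n-1) = (0 1)`, and `Φ(k) = (0 0)` for all other `k`
(for `n > 2`, when `0`, `1`, `n - 1` are different elements of `ℤ/n`). -/
def spinalPhi (n : ℕ) (k : ZMod n) :
    MulAut (Multiplicative (Fin 2 → ZMod n)) ⊕
      (Multiplicative (Fin 2 → ZMod n) →* Multiplicative (ZMod n)) :=
  if k = 0 then .inl (matAut ⟨!![1, 1; 0, 1], by simp [Matrix.det_fin_two]⟩)
  else if k = 1 then .inl (matAut ⟨!![1, 0; 1, 1], by simp [Matrix.det_fin_two]⟩)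
  else if k = -1 then .inr (rowHom ![0, 1])
  else .inr (rowHom ![0, 0])

instance neZero_of_fact_two_lt (n : ℕ) [h : Fact (2 < n)] : NeZero n :=
  ⟨(lt_trans Nat.zero_lt_two h.out).ne'⟩

theorem spinalPhi_neg_one (n : ℕ) [h : Fact (2 < n)] :
    spinalPhi n (-1) = .inr (rowHom ![0, 1]) := by
  have hn := h.out
  have : Fact (1 < n) := ⟨by omega⟩
  have h2 : (2 : ZMod n) ≠ 0 := by
    intro h2
    have : ((2 : ℕ) : ZMod n) = 0 := by exact_mod_cast h2
    rw [ZMod.natCast_eq_zero_iff] at this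
    exact absurd (Nat.le_of_dvd (by norm_num) this) (by omega)
  have h1 : (-1 : ZMod n) ≠ 1 := by
    intro h1
    apply h2
    calc (2 : ZMod n) = 1 - (-1) := by ring
      _ = 0 := by rw [h1]; ring
  simp [spinalPhi, h1]

/-- The multispinal data of `𝔊ₙ`, `n > 2`: `G = (ℤ/n)²`, and `H = ℤ/n` acts on `X = ℤ/n` by
translations. -/
def spinalData (n : ℕ) [Fact (2 < n)] :
    MultispinalData (ZMod n) (Multiplicative (Fin 2 → ZMod n)) (Multiplicative (ZMod n)) where
  Φ := spinalPhi n
  free h x hx := by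
    have : h.toAdd + x = x := hx
    exact Multiplicative.toAdd.injective (by simpa using this)
  s1 := ⟨0, _, by rw [spinalPhi, if_pos rfl]⟩
  s2 := ⟨-1, _, spinalPhi_neg_one n⟩
  s3 g hg := by
    have hn : 2 < n := Fact.out
    have : Fact (1 < n) := ⟨by omega⟩
    have e0 := hg (-1) _ (spinalPhi_neg_one n) 1 (one_mem _)
    have e1 := hg (-1) _ (spinalPhi_neg_one n)
      (matAut ⟨!![1, 0; 1, 1], by simp [Matrix.det_fin_two]⟩)
      (Subgroup.subset_closure ⟨1, by simp [spinalPhi]⟩)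
    have f0 : g.toAdd 1 = 0 := by
      have : (![0, 1] : Fin 2 → ZMod n) ⬝ᵥ g.toAdd = 0 := e0
      simpa [dotProduct, Fin.sum_univ_two] using this
    have f1 : g.toAdd 0 + g.toAdd 1 = 0 := by
      have : (![0, 1] : Fin 2 → ZMod n) ⬝ᵥ (Matrix.mulVec !![1, 0; 1, 1] g.toAdd) = 0 := e1
      simpa [dotProduct, Matrix.mulVec, Fin.sum_univ_two] using this
    apply Multiplicative.toAdd.injective
    funext i
    fin_cases i
    · simpa [f0] using f1
    · exact f0

/-- The multispinal group `𝔊ₙ` over the alphabet `ℤ/n`, for `n > 2`. -/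
abbrev spinalGroup (n : ℕ) [Fact (2 < n)] : Subgroup (Equiv.Perm (List (ZMod n))) :=
  (spinalData n).group

/-! Simplicity is obtained by compressing elements of an ideal. A nonzero element `f` of the ideal,
multiplied on the right by a suitable long word, becomes a nonzero combination of terms `u s` with
`u` a word and `s` in the nucleus, because products of nucleus elements contract
(`exists_mul_word_mem_nucleusSpan`). Stripping letters on the left leaves `a + q` with `a ≠ 0` in
the span of the nucleus and `q` in the positive part (`exists_add_mem_ideal`). If some `t* a z` with
`|t| = |z|` is a nonzero scalar, then `q` stays positive under the same compression and is killed by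
a further one, so the ideal contains 1.

Such `t`, `z` exist when the pushforwards along all `μ ∘ α` separate `K[G]` (`exists_compress`). For
`𝔊ₙ` this is Fourier analysis on `(ℤ/n)²`: every row vector is a multiple of a row in the orbit of
`(0 1)`, so the conditions make all Fourier coefficients of an element vanish. Inversion needs a
primitive character and division by `n²`, that is, `p ∤ n`.

Conversely, if `p ∣ n`, every fibre of every `μ` has order divisible by `p`. The element `∑ g` over
`G` then maps each word to each other word a number of times that is zero in `K`. It therefore acts
as zero on germs of words along an ultrafilter, while germs along a coarser filter, which see all
continuations of `xᵏ` at once, show that it is nonzero. The ultrafilter representation thus has a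
proper nonzero kernel.

For a nonempty set of primes, the square of their product serves as `n`; for the empty set, a
dihedral example over `ℤ/2` is separating over every field. -/

/-! ### Calculus of sections in self-similar groups. -/

section SelfSimilarLemmas

variable {G X : Type*} [Group G] [MulAction G (List X)] [IsSelfSimilar G X]

theorem smul_nil_word (g : G) : g • ([] : List X) = [] :=
  List.length_eq_zero_iff.mp (IsSelfSimilar.length_smul g [])

theorem smul_cons_word (g : G) (x : X) (w : List X) :
    g • (x :: w) = letterAct g x :: letterSection g x • w := by
  have h1 : g • [x] = [letterAct g x] := by
    obtain ⟨y, hy⟩ := List.length_eq_one_iff.mp (IsSelfSimilar.length_smul g [x])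
    simp [letterAct, hy]
  exact (Classical.choose_spec (IsSelfSimilar.exists_section g x) w).trans
    (congrArg (· ++ letterSection g x • w) h1)

theorem letterAct_eq_of {g k : G} {x y : X} (h : ∀ w : List X, g • (x :: w) = y :: k • w) :
    letterAct g x = y := by
  have := h []
  rw [smul_cons_word] at this
  exact (List.cons.inj this).1

theorem letterSection_eq_of {g k : G} {x y : X} (h : ∀ w : List X, g • (x :: w) = y :: k • w) :
    letterSection g x = k := by
  refine FaithfulSMul.eq_of_smul_eq_smul (α := List X) fun w => ?_
  have := h w
  rw [smul_cons_word] at this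
  exact (List.cons.inj this).2

theorem smul_mul_cons_word (a b : G) (x : X) (w : List X) :
    (a * b) • (x :: w) = letterAct a (letterAct b x) ::
      (letterSection a (letterAct b x) * letterSection b x) • w := by
  rw [mul_smul, smul_cons_word, smul_cons_word, mul_smul]

theorem letterAct_mul (a b : G) (x : X) : letterAct (a * b) x = letterAct a (letterAct b x) :=
  letterAct_eq_of (smul_mul_cons_word a b x)

theorem letterSection_mul (a b : G) (x : X) :
    letterSection (a * b) x = letterSection a (letterAct b x) * letterSection b x :=
  letterSection_eq_of (smul_mul_cons_word a b x)

theorem letterAct_one (x : X) : letterAct (1 : G) x = x :=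
  letterAct_eq_of (k := 1) fun w => by simp

theorem wordSection_append (g : G) (u v : List X) :
    wordSection g (u ++ v) = wordSection (wordSection g u) v := by
  induction u generalizing g with
  | nil => rfl
  | cons x u ih => exact ih _

theorem wordSection_mul (a b : G) (w : List X) :
    wordSection (a * b) w = wordSection a (b • w) * wordSection b w := by
  induction w generalizing a b with
  | nil => rw [smul_nil_word]; rfl
  | cons x w ih => rw [smul_cons_word, wordSection, letterSection_mul, ih]; rfl

theorem smul_append_word (g : G) (u v : List X) :
    g • (u ++ v) = g • u ++ wordSection g u • v := by
  induction u generalizing g with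
  | nil => rw [smul_nil_word]; rfl
  | cons x u ih => rw [List.cons_append, smul_cons_word, smul_cons_word, ih]; rfl

/-- A self-similar group with surjective sections on letter stabilizers is self-replicating as soon
as it is transitive on letters. -/
theorem isSelfReplicating_of_letters
    (htrans : ∀ x y : X, ∃ g : G, letterAct g x = y)
    (hsec : ∀ (x : X) (h : G), ∃ g : G, letterAct g x = x ∧ letterSection g x = h) :
    IsSelfReplicating G X := by
  have hsingle : ∀ (g : G) (x : X), g • [x] = [letterAct g x] := fun g x => by
    rw [smul_cons_word, smul_nil_word]
  refine ⟨fun u => ?_, fun x h => ?_⟩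
  · induction u with
    | nil =>
      intro v hv
      exact ⟨1, by rw [one_smul, List.length_eq_zero_iff.mp hv.symm]⟩
    | cons x u ih =>
      intro v hv
      obtain _ | ⟨y, v⟩ := v
      · simp at hv
      obtain ⟨a, ha⟩ := htrans x y
      obtain ⟨k, hk⟩ := ih v (by simpa using hv)
      -- The factor `b` fixes `x` and corrects the section: `(ab)|ₓ = a|ₓ b|ₓ = k`.
      obtain ⟨b, hb, hb'⟩ := hsec x ((letterSection a x)⁻¹ * k)
      refine ⟨a * b, ?_⟩
      rw [smul_mul_cons_word, hb, ha, hb', mul_inv_cancel_left, hk]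
  · obtain ⟨g, hg, hg'⟩ := hsec x h
    exact ⟨g, by rw [hsingle, hg], hg'⟩

end SelfSimilarLemmas

/-! ### Words in the Nekrashevych algebra and compressions `t* y z`. -/

namespace NekrashevychAlgebra

section Basic

variable (K : Type*) {G X : Type*} [Field K] [Group G] [Fintype X] [MulAction G (List X)]
  [IsSelfSimilar G X]

/-- The letter `x` as an element of the Nekrashevych algebra. -/
def letter (x : X) : NekrashevychAlgebra K G X :=
  RingQuot.mkAlgHom K (NekRel K G X) (FreeAlgebra.ι K (.letter x))

/-- The adjoint `x*` of the letter `x`. -/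
def adj (x : X) : NekrashevychAlgebra K G X :=
  RingQuot.mkAlgHom K (NekRel K G X) (FreeAlgebra.ι K (.star x))

/-- The canonical homomorphism from the group to the Nekrashevych algebra. -/
def grp : G →* NekrashevychAlgebra K G X where
  toFun g := RingQuot.mkAlgHom K (NekRel K G X) (FreeAlgebra.ι K (.grp g))
  map_one' := by rw [RingQuot.mkAlgHom_rel K (NekRel.one (K := K) (G := G) (X := X)), map_one]
  map_mul' g h := by rw [← RingQuot.mkAlgHom_rel K (NekRel.mul (X := X) g h), map_mul]

theorem grp_mul_letter (g : G) (x : X) :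
    grp K g * letter K x = letter K (letterAct g x) * grp K (letterSection g x) := by
  have := RingQuot.mkAlgHom_rel K (NekRel.ss (K := K) g x)
  rwa [map_mul, map_mul] at this

theorem adj_mul_letter_same (x : X) : adj K x * letter K x = (1 : NekrashevychAlgebra K G X) := by
  have := RingQuot.mkAlgHom_rel K (NekRel.ck1_same (K := K) (G := G) x)
  rwa [map_mul, map_one] at this

theorem adj_mul_letter_ne {x y : X} (h : x ≠ y) :
    adj K y * letter K x = (0 : NekrashevychAlgebra K G X) := by
  have := RingQuot.mkAlgHom_rel K (NekRel.ck1_ne (K := K) (G := G) x y h)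
  rwa [map_mul, map_zero] at this

theorem sum_letter_mul_adj :
    ∑ x : X, letter K x * adj K x = (1 : NekrashevychAlgebra K G X) := by
  have := RingQuot.mkAlgHom_rel K (NekRel.ck2 (K := K) (G := G) (X := X))
  rw [map_sum, map_one] at this
  simp only [map_mul] at this
  exact this

/-- Induction principle for elements of the Nekrashevych algebra. -/
theorem induction {p : NekrashevychAlgebra K G X → Prop}
    (scalar : ∀ r : K, p (algebraMap K _ r)) (letter : ∀ x, p (letter K x))
    (adj : ∀ x, p (adj K x)) (grp : ∀ g, p (grp K g))
    (mul : ∀ a b, p a → p b → p (a * b)) (add : ∀ a b, p a → p b → p (a + b))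
    (a : NekrashevychAlgebra K G X) : p a := by
  obtain ⟨f, rfl⟩ := RingQuot.mkAlgHom_surjective K (NekRel K G X) a
  induction f with
  | grade0 r => rw [AlgHom.commutes]; exact scalar r
  | grade1 x =>
    cases x with
    | letter x => exact letter x
    | star x => exact adj x
    | grp g => exact grp g
  | mul a b ha hb => rw [map_mul]; exact mul _ _ ha hb
  | add a b ha hb => rw [map_add]; exact add _ _ ha hb

/-- A word as an element of the Nekrashevych algebra. -/
def word : List X → NekrashevychAlgebra K G X
  | [] => 1
  | x :: u => letter K x * word u

/-- The adjoint of a word. -/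
def wordAdj : List X → NekrashevychAlgebra K G X
  | [] => 1
  | x :: u => wordAdj u * adj K x

theorem word_append (u v : List X) :
    (word K (u ++ v) : NekrashevychAlgebra K G X) = word K u * word K v := by
  induction u with
  | nil => simp [word]
  | cons x u ih => rw [List.cons_append, word, ih, word, mul_assoc]

theorem wordAdj_append (u v : List X) :
    (wordAdj K (u ++ v) : NekrashevychAlgebra K G X) = wordAdj K v * wordAdj K u := by
  induction u with
  | nil => simp [wordAdj]
  | cons x u ih => rw [List.cons_append, wordAdj, ih, wordAdj, mul_assoc]

theorem wordAdj_mul_word_self (u : List X) :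
    wordAdj K u * word K u = (1 : NekrashevychAlgebra K G X) := by
  induction u with
  | nil => simp [word, wordAdj]
  | cons x u ih =>
    rw [wordAdj, word, mul_assoc, ← mul_assoc (adj K x), adj_mul_letter_same, one_mul, ih]

theorem wordAdj_mul_word_of_ne {t u : List X} (hl : t.length = u.length) (hne : t ≠ u) :
    wordAdj K t * word K u = (0 : NekrashevychAlgebra K G X) := by
  induction t generalizing u with
  | nil => exact absurd (List.length_eq_zero_iff.mp hl.symm).symm hne
  | cons x t ih =>
    obtain _ | ⟨y, u⟩ := u
    · simp at hl
    rw [wordAdj, word, mul_assoc, ← mul_assoc (adj K x)]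
    by_cases hxy : y = x
    · subst hxy
      rw [adj_mul_letter_same, one_mul, ih (by simpa using hl) (by simpa using hne)]
    · rw [adj_mul_letter_ne K hxy, zero_mul, mul_zero]

theorem grp_mul_word (g : G) (u : List X) :
    grp K g * word K u = word K (g • u) * grp K (wordSection g u) := by
  induction u generalizing g with
  | nil => simp [word, wordSection, smul_nil_word]
  | cons x u ih =>
    rw [word, ← mul_assoc, grp_mul_letter, mul_assoc, ih, smul_cons_word, word, mul_assoc,
      wordSection]

/-- Compressing `s g` by words `t`, `z` of the same length gives zero or an element `s' g'` with
`|s'| = |s|`. -/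
theorem compress_word_mul_grp (t z s : List X) (g : G) (hl : t.length = z.length) :
    wordAdj K t * (word K s * grp K g) * word K z = 0 ∨ ∃ s' g', s'.length = s.length ∧
      wordAdj K t * (word K s * grp K g) * word K z = word K s' * grp K g' := by
  -- Moving `g` past `z` gives `t* r g|_z` with `|r| = |s| + |t|`; this vanishes unless `t` is a
  -- prefix of `r`, and then the remaining suffix has length `|s|`.
  set r := s ++ g • z
  have hr : wordAdj K t * (word K s * grp K g) * word K z =
      wordAdj K t * word K r * grp K (wordSection g z) := by
    rw [word_append, mul_assoc, mul_assoc (word K s), grp_mul_word]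
    simp only [mul_assoc]
  have hlen : r.length = s.length + t.length := by
    simp [r, IsSelfSimilar.length_smul, hl]
  rw [hr, ← List.take_append_drop t.length r, word_append, ← mul_assoc]
  have hlt : t.length = (r.take t.length).length := by simp [hlen]
  by_cases h : t = r.take t.length
  · rw [← h, wordAdj_mul_word_self, one_mul]
    exact .inr ⟨_, _, by simp [hlen], rfl⟩
  · rw [wordAdj_mul_word_of_ne K hlt h, zero_mul, zero_mul]
    exact .inl rfl

/-- Since `∑ x x* = 1`, an element annihilating every letter from the left is zero, so nonvanishing
extends one letter at a time. -/
theorem exists_mul_word_ne_zero {f : NekrashevychAlgebra K G X} (hf : f ≠ 0) (m : ℕ) :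
    ∃ v : List X, v.length = m ∧ f * word K v ≠ 0 := by
  induction m with
  | zero => exact ⟨[], rfl, by simpa [word] using hf⟩
  | succ m ih =>
    obtain ⟨v, hv, hfv⟩ := ih
    by_contra! hcon
    refine hfv ?_
    rw [← mul_one (f * word K v), ← sum_letter_mul_adj, Finset.mul_sum]
    refine Finset.sum_eq_zero fun x _ => ?_
    have := hcon (v ++ [x]) (by simp [hv])
    rw [word_append, word, word, mul_one, ← mul_assoc] at this
    rw [← mul_assoc, this, zero_mul]

/-- The span of the elements `u g` with `u` a nonempty word. -/
def positivePart : Submodule K (NekrashevychAlgebra K G X) :=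
  Submodule.span K {y | ∃ (s : List X) (g : G), s ≠ [] ∧ y = word K s * grp K g}

theorem compress_mem_positivePart {q : NekrashevychAlgebra K G X} (hq : q ∈ positivePart K)
    {t z : List X} (hl : t.length = z.length) :
    wordAdj K t * q * word K z ∈ positivePart (G := G) K := by
  induction hq using Submodule.span_induction with
  | mem q hq =>
    obtain ⟨s, g, hs, rfl⟩ := hq
    obtain h | ⟨s', g', hs', h⟩ := compress_word_mul_grp K t z s g hl
    · rw [h]; exact zero_mem _
    · rw [h]
      refine Submodule.subset_span ⟨s', g', fun h0 => hs ?_, rfl⟩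
      rw [← List.length_eq_zero_iff, ← hs', h0, List.length_nil]
  | zero => simp
  | add a b _ _ ha hb => rw [mul_add, add_mul]; exact add_mem ha hb
  | smul r a _ ha => rw [mul_smul_comm, smul_mul_assoc]; exact Submodule.smul_mem _ _ ha

theorem exists_compress_eq_zero [Nontrivial X] {q : NekrashevychAlgebra K G X}
    (hq : q ∈ positivePart K) (t : List X) :
    ∃ t' : List X, wordAdj K (t ++ t') * q * word K (t ++ t') = 0 := by
  have key : ∀ (q : NekrashevychAlgebra K G X) (t t' : List X),
      wordAdj K (t ++ t') * q * word K (t ++ t') =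
        wordAdj K t' * (wordAdj K t * q * word K t) * word K t' := fun q t t' => by
    rw [word_append, wordAdj_append]; simp only [mul_assoc]
  induction hq using Submodule.span_induction generalizing t with
  | mem q hq =>
    obtain ⟨s, g, hs, rfl⟩ := hq
    obtain h | ⟨s', g', hs', h⟩ := compress_word_mul_grp K t t s g rfl
    · exact ⟨[], by simpa using h⟩
    · obtain _ | ⟨x, r⟩ := s'
      · exact absurd (List.length_eq_zero_iff.mp hs'.symm) hs
      obtain ⟨y, hy⟩ := exists_ne x
      -- This word has the length of `s' = x r` but another first letter, so its adjoint annihilates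
      -- `s'`.
      refine ⟨y :: r, ?_⟩
      rw [key, h, ← mul_assoc, wordAdj_mul_word_of_ne K (by simp) (by simpa using hy), zero_mul,
        zero_mul]
  | zero => exact ⟨[], by simp⟩
  | add a b _ _ ha hb =>
    obtain ⟨t₁, h₁⟩ := ha t
    obtain ⟨t₂, h₂⟩ := hb (t ++ t₁)
    -- Lengthening the compressing word keeps the first summand zero, so the summands can be killed
    -- one after the other.
    refine ⟨t₁ ++ t₂, ?_⟩
    rw [← List.append_assoc, mul_add, add_mul, h₂, key, h₁]
    simp
  | smul r a _ ha =>
    obtain ⟨t', h⟩ := ha t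
    exact ⟨t', by rw [mul_smul_comm, smul_mul_assoc, h, smul_zero]⟩

/-- A two-sided ideal containing a nonzero scalar plus an element of the positive part is the whole
algebra. -/
theorem one_mem_of_scalar_add_mem [Nontrivial X] {I : TwoSidedIdeal (NekrashevychAlgebra K G X)}
    {c : K} (hc : c ≠ 0) {q : NekrashevychAlgebra K G X} (hq : q ∈ positivePart K)
    (hI : algebraMap K _ c + q ∈ I) : 1 ∈ I := by
  obtain ⟨t, ht⟩ := exists_compress_eq_zero K hq []
  have h1 := I.mul_mem_right _ (word K t) (I.mul_mem_left (wordAdj K t) _ hI)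
  rw [List.nil_append] at ht
  rw [mul_add, add_mul, ht, add_zero, ← Algebra.commutes, mul_assoc, wordAdj_mul_word_self,
    mul_one] at h1
  have h2 := I.mul_mem_left (algebraMap K _ c⁻¹) _ h1
  rwa [← map_mul, inv_mul_cancel₀ hc, map_one] at h2

end Basic

/-! ### Representations on `K[S]` from equivariant bijections `X × S ≃ S`. -/

section Representation

variable (K : Type*) {G X S : Type*} [Field K] [Group G] [MulAction G S]

open Classical in
/-- The operators on `K[S]` by which the generators act, given a bijection `X × S ≃ S`. -/
noncomputable def genOp (c : X × S ≃ S) : NekGen G X → Module.End K (S →₀ K)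
  | .letter x => Finsupp.lmapDomain K K fun s => c (x, s)
  | .star x => Finsupp.linearCombination K fun s =>
      if (c.symm s).1 = x then Finsupp.single (c.symm s).2 1 else 0
  | .grp g => Finsupp.lmapDomain K K fun s => g • s

theorem genOp_letter (c : X × S ≃ S) (x : X) (s : S) (r : K) :
    genOp (G := G) K c (.letter x) (Finsupp.single s r) = Finsupp.single (c (x, s)) r := by
  simp [genOp]

open Classical in
theorem genOp_star (c : X × S ≃ S) (x y : X) (s : S) (r : K) :
    genOp (G := G) K c (.star y) (Finsupp.single (c (x, s)) r) =
      if x = y then Finsupp.single s r else 0 := by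
  simp [genOp]

theorem genOp_grp (c : X × S ≃ S) (g : G) (s : S) (r : K) :
    genOp (X := X) K c (.grp g) (Finsupp.single s r) = Finsupp.single (g • s) r := by
  simp [genOp]

variable [Fintype X] [MulAction G (List X)] [IsSelfSimilar G X]

/-- The representation of the Nekrashevych algebra on `K[S]` for a `G`-set `S` with an equivariant
bijection `X × S ≃ S`. -/
noncomputable def rep (c : X × S ≃ S)
    (hc : ∀ (g : G) (x : X) (s : S), g • c (x, s) = c (letterAct g x, letterSection g x • s)) :
    NekrashevychAlgebra K G X →ₐ[K] Module.End K (S →₀ K) :=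
  RingQuot.liftAlgHom K ⟨FreeAlgebra.lift K (genOp K c), by
    classical
    intro a b hab
    have ext_cons : ∀ A B : Module.End K (S →₀ K),
        (∀ x s, A (Finsupp.single (c (x, s)) 1) = B (Finsupp.single (c (x, s)) 1)) → A = B := by
      intro A B h
      refine Finsupp.lhom_ext' fun s => LinearMap.ext_ring ?_
      obtain ⟨⟨x, t⟩, rfl⟩ := c.surjective s
      exact h x t
    cases hab with
    | one =>
      refine ext_cons _ _ fun x s => ?_
      simp [genOp_grp]
    | mul g h =>
      refine ext_cons _ _ fun x s => ?_
      simp [genOp_grp, mul_smul]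
    | ss g x =>
      refine ext_cons _ _ fun y s => ?_
      simp [genOp_grp, genOp_letter, hc]
    | ss_star g x =>
      refine ext_cons _ _ fun y s => ?_
      -- Every basis element is written as `g • c (z, t)`, so that `g⁻¹` simply cancels.
      obtain ⟨z, rfl⟩ : ∃ z, y = letterAct g z :=
        ⟨letterAct g⁻¹ y, by rw [← letterAct_mul, mul_inv_cancel, letterAct_one]⟩
      obtain ⟨t, rfl⟩ : ∃ t, s = letterSection g z • t :=
        ⟨(letterSection g z)⁻¹ • s, by rw [smul_inv_smul]⟩
      have hinj : letterAct g z = letterAct g x ↔ z = x := by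
        refine ⟨fun h => ?_, fun h => by rw [h]⟩
        rw [← letterAct_one (G := G) z, ← letterAct_one (G := G) x, ← inv_mul_cancel g,
          letterAct_mul, letterAct_mul, h]
      simp only [map_mul, FreeAlgebra.lift_ι_apply, Module.End.mul_apply, genOp_star, hinj]
      rw [← hc, genOp_grp, inv_smul_smul, genOp_star]
      split_ifs with h
      · subst h
        rw [genOp_grp, inv_smul_smul]
      · simp
    | ck1_same x =>
      refine ext_cons _ _ fun y s => ?_
      simp [genOp_star, genOp_letter]
    | ck1_ne x y hxy =>
      refine ext_cons _ _ fun z s => ?_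
      simp [genOp_star, genOp_letter, hxy]
    | ck2 =>
      refine ext_cons _ _ fun z s => ?_
      simp [genOp_star, genOp_letter, apply_ite]⟩

theorem rep_grp (c : X × S ≃ S)
    (hc : ∀ (g : G) (x : X) (s : S), g • c (x, s) = c (letterAct g x, letterSection g x • s))
    (g : G) (s : S) (r : K) :
    rep K c hc (grp K g) (Finsupp.single s r) = Finsupp.single (g • s) r := by
  have : rep K c hc (grp K g) = genOp K c (.grp g) :=
    (RingQuot.liftAlgHom_mkAlgHom_apply K _ _ _).trans (FreeAlgebra.lift_ι_apply _ _)
  rw [this, genOp_grp]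

end Representation

end NekrashevychAlgebra

/-! ### Germs of words along a filter, in the role of infinite words. -/

section RegularGerms

open Filter

variable {Ω X : Type*} {l : Filter Ω}

/-- A germ of word-valued functions is regular if all its prefixes of finite length are eventually
constant. -/
def IsRegularGerm (φ : Germ l (List X)) : Prop :=
  ∀ j : ℕ, ∃ u : List X, u.length = j ∧ φ.LiftPred (u <+: ·)

variable (l X) in
/-- The type of regular germs of word-valued functions. -/
abbrev RegularGerm : Type _ := {φ : Germ l (List X) // IsRegularGerm φ}

theorem IsRegularGerm.map_cons {φ : Germ l (List X)} (hφ : IsRegularGerm φ) (x : X) :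
    IsRegularGerm (φ.map (List.cons x)) := by
  intro j
  obtain _ | j := j
  · exact ⟨[], rfl, by
      induction φ using Germ.inductionOn with
      | h f => exact Eventually.of_forall fun _ => List.nil_prefix⟩
  obtain ⟨u, hu, h⟩ := hφ j
  refine ⟨x :: u, by simp [hu], ?_⟩
  induction φ using Germ.inductionOn with
  | h f =>
    refine Eventually.mono (Germ.liftPred_coe.mp h) fun ω hω => ?_
    simpa using hω

/-- Regularity at length 1 gives an eventually constant first letter to split off; this makes
prepending letters surjective, as the relation `∑ x x* = 1` demands. -/
theorem IsRegularGerm.exists_eq_map_cons {φ : Germ l (List X)} (hφ : IsRegularGerm φ) :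
    ∃ (x : X) (ψ : Germ l (List X)), IsRegularGerm ψ ∧ ψ.map (List.cons x) = φ := by
  induction φ using Germ.inductionOn with
  | h f =>
    obtain ⟨u, hu, h⟩ := hφ 1
    obtain ⟨x, rfl⟩ := List.length_eq_one_iff.mp hu
    have hx : ∀ᶠ ω in l, x :: (f ω).tail = f ω :=
      (Germ.liftPred_coe.mp h).mono fun ω ⟨v, hv⟩ => by rw [← hv]; rfl
    refine ⟨x, ((fun ω => (f ω).tail : Ω → List X) : Germ l (List X)), fun j => ?_,
      Germ.coe_eq.mpr hx⟩
    obtain ⟨v, hv, h'⟩ := hφ (j + 1)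
    refine ⟨v.tail, by simp [hv], (Germ.liftPred_coe.mp h').mono fun ω ⟨r, hr⟩ => ⟨r, ?_⟩⟩
    obtain _ | ⟨y, v⟩ := v
    · simp at hv
    · change _ = (f ω).tail
      rw [← hr]; rfl

theorem isRegularGerm_replicate_append (x : X) {k : Ω → ℕ} (hk : Tendsto k l atTop)
    (r : Ω → List X) :
    IsRegularGerm ((fun ω => List.replicate (k ω) x ++ r ω : Ω → List X) : Germ l (List X)) := by
  refine fun j => ⟨List.replicate j x, by simp, ?_⟩
  refine Germ.liftPred_coe.mpr ((hk.eventually_ge_atTop j).mono fun ω hω => ?_)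
  refine List.IsPrefix.trans ?_ (List.prefix_append _ _)
  exact ⟨List.replicate (k ω - j) x, by rw [← List.replicate_add, Nat.add_sub_cancel' hω]⟩

theorem nontrivial_regularGerm_finsupp (K : Type*) [Field K] [Nonempty X] [l.NeBot]
    {k : Ω → ℕ} (hk : Tendsto k l atTop) :
    Nontrivial (RegularGerm X l →₀ K) := by
  have : Nonempty (RegularGerm X l) :=
    ⟨⟨_, isRegularGerm_replicate_append (Classical.arbitrary X) hk fun _ => []⟩⟩
  infer_instance

variable {G : Type*} [Group G] [MulAction G (List X)] [IsSelfSimilar G X]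

theorem IsRegularGerm.smul {φ : Germ l (List X)} (hφ : IsRegularGerm φ) (g : G) :
    IsRegularGerm (g • φ) := by
  intro j
  obtain ⟨u, hu, h⟩ := hφ j
  refine ⟨g • u, by rw [IsSelfSimilar.length_smul, hu], ?_⟩
  induction φ using Germ.inductionOn with
  | h f =>
    refine Eventually.mono (Germ.liftPred_coe.mp h) fun ω ⟨r, hr⟩ => ⟨wordSection g u • r, ?_⟩
    change _ = g • f ω
    rw [← hr, smul_append_word]

instance : MulAction G (RegularGerm X l) where
  smul g φ := ⟨g • φ.1, φ.2.smul g⟩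
  one_smul φ := Subtype.ext (one_smul G φ.1)
  mul_smul g h φ := Subtype.ext (mul_smul g h φ.1)

variable (X l) in
/-- Prepending a letter is a bijection from pairs of a letter and a regular germ to regular
germs. -/
noncomputable def consRegularGerm [l.NeBot] : X × RegularGerm X l ≃ RegularGerm X l :=
  Equiv.ofBijective (fun p => ⟨p.2.1.map (List.cons p.1), p.2.2.map_cons p.1⟩) <| by
    constructor
    · rintro ⟨x, φ, hφ⟩ ⟨y, ψ, hψ⟩ h
      have h := congrArg Subtype.val h
      induction φ using Germ.inductionOn with
      | h f =>
      induction ψ using Germ.inductionOn with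
      | h g =>
      have h : ∀ᶠ ω in l, x :: f ω = y :: g ω := Germ.coe_eq.mp h
      obtain ⟨ω, hω⟩ := h.exists
      obtain rfl : x = y := (List.cons.inj hω).1
      exact Prod.ext rfl (Subtype.ext (Germ.coe_eq.mpr (h.mono fun ω hω => (List.cons.inj hω).2)))
    · rintro ⟨φ, hφ⟩
      obtain ⟨x, ψ, hψ, h⟩ := hφ.exists_eq_map_cons
      exact ⟨⟨x, ψ, hψ⟩, Subtype.ext h⟩

theorem smul_consRegularGerm [l.NeBot] (g : G) (x : X) (φ : RegularGerm X l) :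
    g • consRegularGerm X l (x, φ) =
      consRegularGerm X l (letterAct g x, letterSection g x • φ) := by
  obtain ⟨φ, hφ⟩ := φ
  apply Subtype.ext
  induction φ using Germ.inductionOn with
  | h f =>
    exact Germ.coe_eq.mpr (Eventually.of_forall fun ω => smul_cons_word g x (f ω))

end RegularGerms

namespace NekrashevychAlgebra

variable (K : Type*) {G X : Type*} [Field K] [Group G] [Fintype X] [MulAction G (List X)]
  [IsSelfSimilar G X]

/-- The representation of the Nekrashevych algebra on the space spanned by the regular germs. -/
noncomputable def germRep {Ω : Type*} (l : Filter Ω) [l.NeBot] :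
    NekrashevychAlgebra K G X →ₐ[K] Module.End K (RegularGerm X l →₀ K) :=
  rep K (consRegularGerm X l) smul_consRegularGerm

theorem germRep_grp {Ω : Type*} (l : Filter Ω) [l.NeBot] (g : G) (φ : RegularGerm X l) (r : K) :
    germRep K l (grp K g) (Finsupp.single φ r) = Finsupp.single (g • φ) r :=
  rep_grp K _ _ g φ r

instance [Nonempty X] : Nontrivial (NekrashevychAlgebra K G X) := by
  have := nontrivial_regularGerm_finsupp (l := Filter.atTop) (X := X) K (k := (id : ℕ → ℕ))
    Filter.tendsto_id
  exact (germRep (G := G) (X := X) K (Filter.atTop : Filter ℕ)).toRingHom.domain_nontrivial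

end NekrashevychAlgebra

/-! ### Multispinal groups: sections, contraction, self-replication. -/

namespace MultispinalData

variable {X G H : Type*} [Fintype X] [Group G] [Fintype G] [Group H] [Fintype H] [MulAction H X]

theorem nontrivial_letters (D : MultispinalData X G H) : Nontrivial X := by
  obtain ⟨x, α, hx⟩ := D.s1
  obtain ⟨y, μ, hy⟩ := D.s2
  exact ⟨x, y, fun h => by rw [h, hy] at hx; cases hx⟩

theorem smul_injective (D : MultispinalData X G H) {h k : H} {x : X} (hx : h • x = k • x) :
    h = k := by
  have := D.free (k⁻¹ * h) x (by rw [mul_smul, hx, inv_smul_smul])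
  exact (inv_mul_eq_one.mp this).symm

variable (D : MultispinalData X G H)

theorem run_inl_cons_of_inl {x : X} {α : MulAut G} (hx : D.Φ x = .inl α) (g : G) (w : List X) :
    D.automaton.run (.inl g) (x :: w) = x :: D.automaton.run (.inl (α g)) w := by
  simp [MealyAutomaton.run, automaton, hx]

theorem run_inl_cons_of_inr {x : X} {μ : G →* H} (hx : D.Φ x = .inr μ) (g : G) (w : List X) :
    D.automaton.run (.inl g) (x :: w) = x :: D.automaton.run (.inr (μ g)) w := by
  simp [MealyAutomaton.run, automaton, hx]

theorem run_inr_one (w : List X) : D.automaton.run (.inr 1) w = w := by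
  induction w with
  | nil => rfl
  | cons x w ih =>
    change (1 : H) • x :: D.automaton.run (.inr 1) w = _
    rw [ih, one_smul]

theorem run_inr_cons (h : H) (x : X) (w : List X) :
    D.automaton.run (.inr h) (x :: w) = h • x :: w :=
  congrArg (h • x :: ·) (D.run_inr_one w)

theorem run_inr_mul (h k : H) (w : List X) :
    D.automaton.run (.inr (h * k)) w = D.automaton.run (.inr h) (D.automaton.run (.inr k) w) := by
  obtain _ | ⟨x, w⟩ := w
  · rfl
  · rw [run_inr_cons, run_inr_cons, run_inr_cons, mul_smul]

theorem run_inl_mul (g k : G) (w : List X) :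
    D.automaton.run (.inl (g * k)) w = D.automaton.run (.inl g) (D.automaton.run (.inl k) w) := by
  induction w generalizing g k with
  | nil => rfl
  | cons x w ih =>
    cases hx : D.Φ x with
    | inl α => simp only [D.run_inl_cons_of_inl hx, map_mul, ih]
    | inr μ => simp only [D.run_inl_cons_of_inr hx, map_mul, run_inr_mul]

/-- The state `q` as an element of the multispinal group. -/
def state (q : G ⊕ H) : D.group :=
  ⟨D.automaton.statePerm q, Subgroup.subset_closure ⟨q, rfl⟩⟩

/-- The homomorphism from `G` to the multispinal group. -/
def ofG : G →* D.group :=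
  MonoidHom.mk' (fun g => D.state (.inl g)) fun g k =>
    Subtype.ext (Equiv.ext fun w => D.run_inl_mul g k w)

/-- The homomorphism from `H` to the multispinal group. -/
def ofH : H →* D.group :=
  MonoidHom.mk' (fun g => D.state (.inr g)) fun g k =>
    Subtype.ext (Equiv.ext fun w => D.run_inr_mul g k w)

variable {D}

theorem ofG_smul_cons_of_inl {x : X} {α : MulAut G} (hx : D.Φ x = .inl α) (g : G) (w : List X) :
    D.ofG g • (x :: w) = x :: D.ofG (α g) • w :=
  D.run_inl_cons_of_inl hx g w

theorem ofG_smul_cons_of_inr {x : X} {μ : G →* H} (hx : D.Φ x = .inr μ) (g : G) (w : List X) :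
    D.ofG g • (x :: w) = x :: D.ofH (μ g) • w :=
  D.run_inl_cons_of_inr hx g w

theorem ofH_smul_cons (h : H) (x : X) (w : List X) :
    D.ofH h • (x :: w) = h • x :: (1 : D.group) • w :=
  D.run_inr_cons h x w

theorem letterAct_ofH (h : H) (x : X) : letterAct (D.ofH h) x = h • x :=
  letterAct_eq_of (ofH_smul_cons h x)

theorem letterSection_ofH (h : H) (x : X) : letterSection (D.ofH h) x = 1 :=
  letterSection_eq_of (ofH_smul_cons h x)

theorem letterAct_ofG (g : G) (x : X) : letterAct (D.ofG g) x = x := by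
  cases hx : D.Φ x with
  | inl α => exact letterAct_eq_of (ofG_smul_cons_of_inl hx g)
  | inr μ => exact letterAct_eq_of (ofG_smul_cons_of_inr hx g)

theorem letterSection_ofG_of_inl {x : X} {α : MulAut G} (hx : D.Φ x = .inl α) (g : G) :
    letterSection (D.ofG g) x = D.ofG (α g) :=
  letterSection_eq_of (ofG_smul_cons_of_inl hx g)

theorem letterSection_ofG_of_inr {x : X} {μ : G →* H} (hx : D.Φ x = .inr μ) (g : G) :
    letterSection (D.ofG g) x = D.ofH (μ g) :=
  letterSection_eq_of (ofG_smul_cons_of_inr hx g)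

variable (D) in
/-- The group generated by the automorphisms among the `Φ(x)`. -/
def autGroup : Subgroup (MulAut G) :=
  Subgroup.closure {β | ∃ y : X, D.Φ y = .inl β}

/-- Every element of the group generated by the automorphisms `Φ(x)` is realized by the sections
at some word. -/
theorem exists_word_section {α : MulAut G} (hα : α ∈ D.autGroup) :
    ∃ z : List X, ∀ g : G, D.ofG g • z = z ∧ wordSection (D.ofG g) z = D.ofG (α g) := by
  -- Only the generators themselves occur as sections; as `Aut(G)` is finite, they already generate
  -- the group as a monoid.
  rw [autGroup, ← Subgroup.mem_toSubmonoid, Subgroup.closure_toSubmonoid_of_finite] at hα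
  induction hα using Submonoid.closure_induction with
  | mem β hβ =>
    obtain ⟨y, hy⟩ := hβ
    exact ⟨[y], fun g => ⟨by rw [ofG_smul_cons_of_inl hy, smul_nil_word],
      letterSection_ofG_of_inl hy g⟩⟩
  | one => exact ⟨[], fun g => ⟨smul_nil_word _, rfl⟩⟩
  | mul α β _ _ hα hβ =>
    obtain ⟨z, hz⟩ := hα
    obtain ⟨z', hz'⟩ := hβ
    refine ⟨z' ++ z, fun g => ⟨?_, ?_⟩⟩
    · rw [smul_append_word, (hz' g).1, (hz' g).2, (hz _).1]
    · rw [wordSection_append, (hz' g).2, (hz _).2]; rfl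

/-- A nontrivial element of `G` moves some word. -/
theorem exists_ofG_smul_ne {g : G} (hg : g ≠ 1) : ∃ w : List X, D.ofG g • w ≠ w := by
  by_contra! hcon
  refine hg (D.s3 g fun x μ hx α hα => ?_)
  obtain ⟨z, hz⟩ := exists_word_section (D := D) hα
  -- The word `z` produces `α g`, the first `x` turns it into `μ (α g)`, and the second `x` is moved
  -- unless this is 1, because `H` acts freely.
  have h := hcon (z ++ ([x] ++ [x]))
  rw [smul_append_word, (hz g).1, (hz g).2, List.append_cancel_left_eq, List.singleton_append,
    ofG_smul_cons_of_inr hx, ofH_smul_cons, one_smul] at h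
  exact D.free _ x (by simpa using h)

variable (D) in
/-- The nucleus of a multispinal group: the set of elements given by the states. -/
def nucleus : Set D.group := Set.range D.ofG ∪ Set.range D.ofH

theorem ofG_mem_nucleus (g : G) : D.ofG g ∈ D.nucleus := .inl ⟨g, rfl⟩

theorem ofH_mem_nucleus (h : H) : D.ofH h ∈ D.nucleus := .inr ⟨h, rfl⟩

theorem one_mem_nucleus : 1 ∈ D.nucleus := .inl ⟨1, map_one _⟩

theorem letterSection_ofG_mem_nucleus (g : G) (x : X) :
    letterSection (D.ofG g) x ∈ D.nucleus := by
  cases hx : D.Φ x with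
  | inl α => rw [letterSection_ofG_of_inl hx]; exact ofG_mem_nucleus _
  | inr μ => rw [letterSection_ofG_of_inr hx]; exact ofH_mem_nucleus _

theorem letterSection_mem_nucleus {s : D.group} (hs : s ∈ D.nucleus) (x : X) :
    letterSection s x ∈ D.nucleus := by
  obtain ⟨g, rfl⟩ | ⟨h, rfl⟩ := hs
  · exact letterSection_ofG_mem_nucleus g x
  · rw [letterSection_ofH]; exact one_mem_nucleus

theorem wordSection_mem_nucleus {s : D.group} (hs : s ∈ D.nucleus) (w : List X) :
    wordSection s w ∈ D.nucleus := by
  induction w generalizing s with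
  | nil => exact hs
  | cons x w ih => exact ih (letterSection_mem_nucleus hs x)

/-- Sections of `H` at letters are trivial, and `G` is closed under products, so a product of two
nucleus elements returns to the nucleus after one letter. Contraction and the absorption of algebra
elements by long words both rest on this. -/
theorem letterSection_mul_mem_nucleus {s t : D.group} (hs : s ∈ D.nucleus) (ht : t ∈ D.nucleus)
    (x : X) : letterSection (s * t) x ∈ D.nucleus := by
  rw [letterSection_mul]
  obtain ⟨h, rfl⟩ | ⟨h, rfl⟩ := ht
  · obtain ⟨g, rfl⟩ | ⟨g, rfl⟩ := hs
    · rw [← letterSection_mul, ← map_mul]; exact letterSection_ofG_mem_nucleus _ x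
    · rw [letterSection_ofH, one_mul]; exact letterSection_ofG_mem_nucleus h x
  · rw [letterSection_ofH, mul_one]; exact letterSection_mem_nucleus hs _

/-- Induction on elements of a multispinal group as products of elements of the nucleus. -/
theorem group_induction {p : D.group → Prop} (one : p 1)
    (mul : ∀ s ∈ D.nucleus, ∀ γ, p γ → p (s * γ)) (γ : D.group) : p γ := by
  obtain ⟨γ, hγ⟩ := γ
  induction hγ using Subgroup.closure_induction_left with
  | one => exact one
  | mul_left s hs γ hγ ih =>
    obtain ⟨q | q, rfl⟩ := hs
    · exact mul _ (ofG_mem_nucleus q) ⟨γ, hγ⟩ ih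
    · exact mul _ (ofH_mem_nucleus q) ⟨γ, hγ⟩ ih
  | inv_mul_cancel s hs γ hγ ih =>
    obtain ⟨q | q, rfl⟩ := hs
    · have := mul _ (ofG_mem_nucleus q⁻¹) ⟨γ, hγ⟩ ih
      rwa [map_inv] at this
    · have := mul _ (ofH_mem_nucleus q⁻¹) ⟨γ, hγ⟩ ih
      rwa [map_inv] at this

theorem isContracting : IsContracting D.group X := by
  refine ⟨D.nucleus, (Set.finite_range _).union (Set.finite_range _),
    fun a ha x => letterSection_mem_nucleus ha x, fun g => ?_⟩
  induction g using group_induction with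
  | one => exact ⟨0, fun w _ => wordSection_mem_nucleus one_mem_nucleus w⟩
  | mul s hs γ ih =>
    obtain ⟨n, hn⟩ := ih
    refine ⟨n + 1, fun w hw => ?_⟩
    rw [← List.take_append_drop n w, wordSection_append, wordSection_mul]
    obtain ⟨x, hx⟩ : ∃ x, w.drop n = [x] := List.length_eq_one_iff.mp (by simp [hw])
    rw [hx]
    exact letterSection_mul_mem_nucleus (wordSection_mem_nucleus hs _)
      (hn _ (by simp [hw])) x

theorem isSelfReplicating (htrans : ∀ x y : X, ∃ h : H, h • x = y)
    (hsurj : ∃ (x : X) (μ : G →* H), D.Φ x = .inr μ ∧ Function.Surjective μ) :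
    IsSelfReplicating D.group X := by
  refine isSelfReplicating_of_letters (fun x y => ?_) fun x γ => ?_
  · obtain ⟨h, hh⟩ := htrans x y
    exact ⟨D.ofH h, by rw [letterAct_ofH, hh]⟩
  -- Conjugating by an element of `H`, which has trivial sections, moves the section of `g` at `y`
  -- to the letter `x`.
  · have conj : ∀ (g : G) (y : X), ∃ γ : D.group, letterAct γ x = x ∧
        letterSection γ x = letterSection (D.ofG g) y := by
      intro g y
      obtain ⟨h, hh⟩ := htrans x y
      refine ⟨D.ofH h⁻¹ * (D.ofG g * D.ofH h), ?_, ?_⟩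
      · rw [letterAct_mul, letterAct_mul, letterAct_ofH, letterAct_ofG, letterAct_ofH,
          inv_smul_smul]
      · rw [letterSection_mul, letterSection_mul, letterSection_ofH, letterSection_ofH,
          letterAct_ofH, hh, one_mul, mul_one]
    induction γ using group_induction with
    | one => exact ⟨1, letterAct_one x, letterSection_eq_of (y := x) fun w => by simp⟩
    | mul s hs γ ih =>
      obtain ⟨a, ha, ha'⟩ : ∃ a : D.group, letterAct a x = x ∧ letterSection a x = s := by
        obtain ⟨g, rfl⟩ | ⟨h, rfl⟩ := hs
        · obtain ⟨y, α, hy⟩ := D.s1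
          obtain ⟨a, ha, ha'⟩ := conj (α.symm g) y
          refine ⟨a, ha, ?_⟩
          rw [ha', letterSection_ofG_of_inl hy, MulEquiv.apply_symm_apply]
        · obtain ⟨y, μ, hy, hμ⟩ := hsurj
          obtain ⟨g, rfl⟩ := hμ h
          obtain ⟨a, ha, ha'⟩ := conj g y
          exact ⟨a, ha, by rw [ha', letterSection_ofG_of_inr hy]⟩
      obtain ⟨b, hb, hb'⟩ := ih
      exact ⟨a * b, by rw [letterAct_mul, hb, ha], by rw [letterSection_mul, hb, ha', hb']⟩

end MultispinalData

/-! ### Simplicity when the homomorphisms `μ ∘ α` separate `K[G]`. -/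

namespace MultispinalData

open NekrashevychAlgebra

variable {X G H : Type*} [Fintype X] [Group G] [Fintype G] [Group H] [Fintype H] [MulAction H X]
  {D : MultispinalData X G H} (K : Type*) [Field K]

theorem grp_ofH_mul_letter (h : H) (x : X) :
    grp K (D.ofH h) * letter K x = letter K (h • x) := by
  rw [grp_mul_letter, letterAct_ofH, letterSection_ofH, map_one, mul_one]

variable (D) in
/-- The span of the elements `u s` with `u` a word of length at most `L` and `s` in the nucleus. -/
def nucleusSpan (L : ℕ) : Submodule K (NekrashevychAlgebra K D.group X) :=
  Submodule.span K {y | ∃ (u : List X), ∃ s ∈ D.nucleus, u.length ≤ L ∧ y = word K u * grp K s}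

variable (D) in
/-- The span of the elements `u s` with `u` a word and `s` in the nucleus. -/
def nucleusSpanTop : Submodule K (NekrashevychAlgebra K D.group X) :=
  Submodule.span K {y | ∃ (u : List X), ∃ s ∈ D.nucleus, y = word K u * grp K s}

theorem nucleusSpan_mono {L M : ℕ} (h : L ≤ M) : D.nucleusSpan K L ≤ D.nucleusSpan K M := by
  refine Submodule.span_mono ?_
  rintro y ⟨u, s, hs, hu, rfl⟩
  exact ⟨u, s, hs, hu.trans h, rfl⟩

theorem exists_mem_nucleusSpan {y : NekrashevychAlgebra K D.group X}
    (hy : y ∈ D.nucleusSpanTop K) : ∃ L, y ∈ D.nucleusSpan K L := by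
  induction hy using Submodule.span_induction with
  | mem y hy =>
    obtain ⟨u, s, hs, rfl⟩ := hy
    exact ⟨u.length, Submodule.subset_span ⟨u, s, hs, le_rfl, rfl⟩⟩
  | zero => exact ⟨0, zero_mem _⟩
  | add a b _ _ ha hb =>
    obtain ⟨L, hL⟩ := ha
    obtain ⟨M, hM⟩ := hb
    exact ⟨max L M, add_mem (nucleusSpan_mono K (le_max_left L M) hL)
      (nucleusSpan_mono K (le_max_right L M) hM)⟩
  | smul r a _ ha =>
    obtain ⟨L, hL⟩ := ha
    exact ⟨L, Submodule.smul_mem _ _ hL⟩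

/-- The map `y ↦ e y v` preserves the span of the elements `u s` if it maps these elements into
their span. -/
theorem mul_word_mem_nucleusSpanTop {e : NekrashevychAlgebra K D.group X} {v : List X}
    (h : ∀ (u : List X), ∀ s ∈ D.nucleus, e * (word K u * grp K s) * word K v ∈ D.nucleusSpanTop K)
    {y : NekrashevychAlgebra K D.group X} (hy : y ∈ D.nucleusSpanTop K) :
    e * y * word K v ∈ D.nucleusSpanTop K := by
  induction hy using Submodule.span_induction with
  | mem y hy =>
    obtain ⟨u, s, hs, rfl⟩ := hy
    exact h u s hs
  | zero => simp
  | add a b _ _ ha hb => rw [mul_add, add_mul]; exact add_mem ha hb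
  | smul r a _ ha => rw [mul_smul_comm, smul_mul_assoc]; exact Submodule.smul_mem _ _ ha

/-- A long word on the right absorbs `e`: each adjoint letter or nucleus factor in `e` uses up at
most one letter of `v`, respectively to be cancelled and to contract a product of two nucleus
elements. -/
theorem exists_length_mul_mem_nucleusSpanTop (e : NekrashevychAlgebra K D.group X) :
    ∃ m : ℕ, ∀ y ∈ D.nucleusSpanTop K, ∀ v : List X, m ≤ v.length →
      e * y * word K v ∈ D.nucleusSpanTop K := by
  have right : ∀ y ∈ D.nucleusSpanTop K, ∀ v : List X, y * word K v ∈ D.nucleusSpanTop K := by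
    intro y hy v
    rw [← one_mul y]
    refine mul_word_mem_nucleusSpanTop K (fun u s hs => ?_) hy
    rw [one_mul, mul_assoc, grp_mul_word, ← mul_assoc, ← word_append]
    exact Submodule.subset_span ⟨_, _, wordSection_mem_nucleus hs v, rfl⟩
  have mul : ∀ a b : NekrashevychAlgebra K D.group X,
      (∃ m : ℕ, ∀ y ∈ D.nucleusSpanTop K, ∀ v : List X, m ≤ v.length →
        a * y * word K v ∈ D.nucleusSpanTop K) →
      (∃ m : ℕ, ∀ y ∈ D.nucleusSpanTop K, ∀ v : List X, m ≤ v.length →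
        b * y * word K v ∈ D.nucleusSpanTop K) →
      ∃ m : ℕ, ∀ y ∈ D.nucleusSpanTop K, ∀ v : List X, m ≤ v.length →
        a * b * y * word K v ∈ D.nucleusSpanTop K := by
    rintro a b ⟨m, hm⟩ ⟨n, hn⟩
    refine ⟨n + m, fun y hy v hv => ?_⟩
    rw [← List.take_append_drop n v, word_append, ← mul_assoc, mul_assoc a, mul_assoc a]
    exact hm _ (hn y hy _ (by rw [List.length_take]; omega)) _ (by rw [List.length_drop]; omega)
  induction e using NekrashevychAlgebra.induction with
  | scalar r =>
    refine ⟨0, fun y hy v _ => ?_⟩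
    rw [← Algebra.smul_def, smul_mul_assoc]
    exact Submodule.smul_mem _ _ (right y hy v)
  | letter x =>
    refine ⟨0, fun y hy v _ => ?_⟩
    rw [mul_assoc]
    have := right y hy v
    rw [← mul_one (letter K x * _)]
    refine mul_word_mem_nucleusSpanTop K (v := []) (fun u s hs => ?_) this
    rw [word, mul_one, ← mul_assoc]
    exact Submodule.subset_span ⟨x :: u, s, hs, rfl⟩
  | adj x =>
    refine ⟨1, fun y hy v hv => mul_word_mem_nucleusSpanTop K (fun u s hs => ?_) hy⟩
    rw [mul_assoc, mul_assoc, grp_mul_word, ← mul_assoc (word K u), ← word_append, ← mul_assoc]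
    obtain ⟨z, r, hr⟩ : ∃ z r, u ++ s • v = z :: r := by
      refine List.exists_cons_of_length_pos ?_
      rw [List.length_append, IsSelfSimilar.length_smul]
      omega
    rw [hr, word, ← mul_assoc]
    by_cases hz : z = x
    · rw [hz, adj_mul_letter_same, one_mul]
      exact Submodule.subset_span ⟨_, _, wordSection_mem_nucleus hs v, rfl⟩
    · rw [adj_mul_letter_ne K hz, zero_mul, zero_mul]
      exact zero_mem _
  | grp g =>
    induction g using group_induction with
    | one => exact ⟨0, fun y hy v _ => by rw [map_one, one_mul]; exact right y hy v⟩
    | mul s hs γ ih =>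
      rw [map_mul]
      refine mul _ _ ⟨1, fun y hy v hv => mul_word_mem_nucleusSpanTop K (fun u t ht => ?_) hy⟩ ih
      rw [← mul_assoc, grp_mul_word, mul_assoc (word K _), ← map_mul, mul_assoc, grp_mul_word,
        ← mul_assoc, ← word_append]
      obtain _ | ⟨x, r⟩ := v
      · simp at hv
      exact Submodule.subset_span ⟨_, _, wordSection_mem_nucleus (letterSection_mul_mem_nucleus
        (wordSection_mem_nucleus hs u) ht x) r, rfl⟩
  | mul a b ha hb => exact mul a b ha hb
  | add a b ha hb =>
    obtain ⟨m, hm⟩ := ha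
    obtain ⟨n, hn⟩ := hb
    refine ⟨m + n, fun y hy v hv => ?_⟩
    rw [add_mul, add_mul]
    exact add_mem (hm y hy v (by omega)) (hn y hy v (by omega))

theorem exists_mul_word_mem_nucleusSpan {f : NekrashevychAlgebra K D.group X} (hf : f ≠ 0) :
    ∃ (v : List X) (L : ℕ), f * word K v ≠ 0 ∧ f * word K v ∈ D.nucleusSpan K L := by
  obtain ⟨m, hm⟩ := exists_length_mul_mem_nucleusSpanTop K f
  obtain ⟨v, hv, hfv⟩ := exists_mul_word_ne_zero K hf m
  have h1 : (1 : NekrashevychAlgebra K D.group X) ∈ D.nucleusSpanTop K :=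
    Submodule.subset_span ⟨[], 1, one_mem_nucleus, by rw [word, map_one, mul_one]⟩
  have h2 := hm 1 h1 v hv.ge
  rw [mul_one] at h2
  obtain ⟨L, hL⟩ := exists_mem_nucleusSpan K h2
  exact ⟨v, L, hfv, hL⟩

theorem eq_add_sum_of_mem_nucleusSpan {L : ℕ} {y : NekrashevychAlgebra K D.group X}
    (hy : y ∈ D.nucleusSpan K (L + 1)) :
    ∃ a ∈ D.nucleusSpan K 0, ∃ f : X → NekrashevychAlgebra K D.group X,
      (∀ x, f x ∈ D.nucleusSpan K L) ∧ y = a + ∑ x, letter K x * f x := by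
  classical
  induction hy using Submodule.span_induction with
  | mem y hy =>
    obtain ⟨u, s, hs, hu, rfl⟩ := hy
    obtain _ | ⟨x, u⟩ := u
    · exact ⟨_, Submodule.subset_span ⟨[], s, hs, le_rfl, rfl⟩, 0, fun x => zero_mem _, by simp⟩
    · refine ⟨0, zero_mem _, Pi.single x (word K u * grp K s), fun z => ?_, ?_⟩
      · by_cases hz : z = x
        · subst hz
          rw [Pi.single_eq_same]
          exact Submodule.subset_span ⟨u, s, hs, by simpa using hu, rfl⟩
        · rw [Pi.single_eq_of_ne hz]
          exact zero_mem _
      · rw [zero_add, Finset.sum_eq_single x (fun z _ hz => by rw [Pi.single_eq_of_ne hz, mul_zero])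
          (by simp), Pi.single_eq_same, word, mul_assoc]
  | zero => exact ⟨0, zero_mem _, 0, fun _ => zero_mem _, by simp⟩
  | add y z _ _ hy hz =>
    obtain ⟨a, ha, f, hf, rfl⟩ := hy
    obtain ⟨b, hb, g, hg, rfl⟩ := hz
    refine ⟨a + b, add_mem ha hb, f + g, fun x => add_mem (hf x) (hg x), ?_⟩
    simp only [Pi.add_apply, mul_add, Finset.sum_add_distrib]
    abel
  | smul r y _ hy =>
    obtain ⟨a, ha, f, hf, rfl⟩ := hy
    refine ⟨r • a, Submodule.smul_mem _ _ ha, r • f, fun x => Submodule.smul_mem _ _ (hf x), ?_⟩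
    simp only [Pi.smul_apply, mul_smul_comm, smul_add, Finset.smul_sum]

theorem letter_mul_mem_positivePart {L : ℕ} {y : NekrashevychAlgebra K D.group X}
    (hy : y ∈ D.nucleusSpan K L) (x : X) : letter K x * y ∈ positivePart K := by
  induction hy using Submodule.span_induction with
  | mem y hy =>
    obtain ⟨u, s, hs, hu, rfl⟩ := hy
    exact Submodule.subset_span ⟨x :: u, s, by simp, by rw [word, mul_assoc]⟩
  | zero => simp
  | add a b _ _ ha hb => rw [mul_add]; exact add_mem ha hb
  | smul r a _ ha => rw [mul_smul_comm]; exact Submodule.smul_mem _ _ ha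

/-- An ideal with a nonzero element in the span of the elements `u s`, `s` in the nucleus, has an
element whose part of degree zero is a nonzero element of the span of the nucleus. -/
theorem exists_add_mem_ideal {I : TwoSidedIdeal (NekrashevychAlgebra K D.group X)} {L : ℕ}
    {y : NekrashevychAlgebra K D.group X} (hy : y ∈ D.nucleusSpan K L) (hy0 : y ≠ 0) (hI : y ∈ I) :
    ∃ a ∈ D.nucleusSpan K 0, a ≠ 0 ∧ ∃ q ∈ positivePart K, a + q ∈ I := by
  induction L generalizing y with
  | zero => exact ⟨y, hy, hy0, 0, zero_mem _, by rwa [add_zero]⟩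
  | succ L ih =>
    obtain ⟨a, ha, f, hf, rfl⟩ := eq_add_sum_of_mem_nucleusSpan K hy
    -- If the degree-zero part vanishes, multiplying by `x*` isolates some nonzero `f x`, whose
    -- words are shorter.
    by_cases ha0 : a = 0
    · subst ha0
      rw [zero_add] at hy0 hI
      obtain ⟨x, -, hx⟩ := Finset.exists_ne_zero_of_sum_ne_zero hy0
      have hfx : adj K x * ∑ z, letter K z * f z = f x := by
        rw [Finset.mul_sum, Finset.sum_eq_single x, ← mul_assoc, adj_mul_letter_same, one_mul]
        · intro z _ hz
          rw [← mul_assoc, adj_mul_letter_ne K hz, zero_mul]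
        · simp
      refine ih (hf x) (fun h => hx (by rw [h, mul_zero])) ?_
      rw [← hfx]
      exact I.mul_mem_left _ _ hI
    · exact ⟨a, ha, ha0, _, sum_mem fun x _ => letter_mul_mem_positivePart K (hf x) x, hI⟩

theorem eq_sum_of_mem_nucleusSpan_zero {a : NekrashevychAlgebra K D.group X}
    (ha : a ∈ D.nucleusSpan K 0) :
    ∃ (b : G → K) (c : H → K), a = ∑ g, b g • grp K (D.ofG g) + ∑ h, c h • grp K (D.ofH h) := by
  classical
  induction ha using Submodule.span_induction with
  | mem a ha =>
    obtain ⟨u, s, hs, hu, rfl⟩ := ha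
    rw [List.length_eq_zero_iff.mp (Nat.le_zero.mp hu), word, one_mul]
    obtain ⟨g, rfl⟩ | ⟨h, rfl⟩ := hs
    · exact ⟨Pi.single g 1, 0, by simp [Pi.single_apply]⟩
    · exact ⟨0, Pi.single h 1, by simp [Pi.single_apply]⟩
  | zero => exact ⟨0, 0, by simp⟩
  | add x y _ _ hx hy =>
    obtain ⟨b, c, rfl⟩ := hx
    obtain ⟨b', c', rfl⟩ := hy
    refine ⟨b + b', c + c', ?_⟩
    simp only [Pi.add_apply, add_smul, Finset.sum_add_distrib]
    abel
  | smul r x _ hx =>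
    obtain ⟨b, c, rfl⟩ := hx
    exact ⟨r • b, r • c, by simp only [Pi.smul_apply, smul_add, Finset.smul_sum, smul_assoc]⟩

variable (D) in
open Classical in
/-- The homomorphisms `μ ∘ α` separate the elements of the group algebra `K[G]`. -/
def IsSeparating : Prop :=
  ∀ a : G → K, (∀ (x : X) (μ : G →* H), D.Φ x = .inr μ → ∀ α ∈ D.autGroup, ∀ h : H,
    ∑ g with μ (α g) = h, a g = 0) → a = 0

variable {K}

/-- Compressing by `(hx)*` and `x` selects the coefficient of `h`: elements of `G` fix `x ≠ hx`, and
by freeness only `h` in `H` sends `x` to `hx`. -/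
theorem exists_compress_of_ofH_ne_one (b : G → K) (c : H → K) {h : H} (hh : h ≠ 1)
    (hc : c h ≠ 0) :
    ∃ (t z : List X) (r : K), t.length = z.length ∧ r ≠ 0 ∧
      wordAdj K t * (∑ g, b g • grp K (D.ofG g) + ∑ h, c h • grp K (D.ofH h)) * word K z =
        algebraMap K _ r := by
  obtain ⟨x, -⟩ := D.s1
  refine ⟨[h • x], [x], c h, rfl, hc, ?_⟩
  have hx : x ≠ h • x := fun hx => hh (D.free h x hx.symm)
  simp only [wordAdj, word, mul_one, one_mul, mul_add, add_mul, Finset.mul_sum, Finset.sum_mul,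
    mul_smul_comm, smul_mul_assoc, mul_assoc]
  rw [Finset.sum_eq_zero, zero_add, Finset.sum_eq_single h, grp_ofH_mul_letter,
    adj_mul_letter_same, Algebra.algebraMap_eq_smul_one]
  · intro k _ hk
    rw [grp_ofH_mul_letter, adj_mul_letter_ne K fun h' => hk (D.smul_injective h'), smul_zero]
  · simp
  · intro g _
    rw [grp_mul_letter, letterAct_ofG, ← mul_assoc, adj_mul_letter_ne K hx, zero_mul, smul_zero]

theorem exists_compress_of_ofH {c : H → K} (hc : c ≠ 0) :
    ∃ (t z : List X) (r : K), t.length = z.length ∧ r ≠ 0 ∧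
      wordAdj K t * (∑ h, c h • grp K (D.ofH h)) * word K z = algebraMap K _ r := by
  by_cases h : ∃ h ≠ 1, c h ≠ 0
  · obtain ⟨h, hh, hch⟩ := h
    simpa using exists_compress_of_ofH_ne_one (D := D) 0 c hh hch
  · push Not at h
    refine ⟨[], [], c 1, rfl, fun h1 => hc (funext fun k => ?_), ?_⟩
    · by_cases hk : k = 1
      · rw [hk, h1]; rfl
      · exact h k hk
    · rw [Finset.sum_eq_single 1 (fun k _ hk => by rw [h k hk, zero_smul]) (by simp), map_one,
        map_one, wordAdj, word, one_mul, mul_one, Algebra.algebraMap_eq_smul_one]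

/-- Compression by a word realizing `α`, followed by a letter with `Φ(x) = μ`, pushes `b` forward
along `μ ∘ α` to `K[H]`. Separation gives a choice with nonzero image. -/
theorem exists_compress_of_ofG (hD : D.IsSeparating K) {b : G → K} (hb : b ≠ 0) :
    ∃ (t z : List X) (r : K), t.length = z.length ∧ r ≠ 0 ∧
      wordAdj K t * (∑ g, b g • grp K (D.ofG g)) * word K z = algebraMap K _ r := by
  classical
  have hsep := mt (hD b) hb
  push Not at hsep
  obtain ⟨x, μ, hx, α, hα, k, hk⟩ := hsep
  obtain ⟨w, hw⟩ := exists_word_section (D := D) hα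
  set c : H → K := fun h => ∑ g with μ (α g) = h, b g
  have hc : c ≠ 0 := by
    refine fun h0 => hk ?_
    exact congrFun h0 k
  have key : wordAdj K (w ++ [x]) * (∑ g, b g • grp K (D.ofG g)) * word K (w ++ [x]) =
      ∑ h, c h • grp K (D.ofH h) := by
    have h1 : ∀ g : G, wordAdj K (w ++ [x]) * grp K (D.ofG g) * word K (w ++ [x]) =
        grp K (D.ofH (μ (α g))) := by
      intro g
      have h2 : D.ofG g • (w ++ [x]) = w ++ [x] := by
        rw [smul_append_word, (hw g).1, (hw g).2, ofG_smul_cons_of_inr hx, smul_nil_word]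
      have h3 : wordSection (D.ofG g) (w ++ [x]) = D.ofH (μ (α g)) := by
        rw [wordSection_append, (hw g).2]
        exact letterSection_ofG_of_inr hx _
      rw [mul_assoc, grp_mul_word, h2, h3, ← mul_assoc, wordAdj_mul_word_self, one_mul]
    simp only [Finset.mul_sum, Finset.sum_mul, mul_smul_comm, smul_mul_assoc, h1]
    rw [← Finset.sum_fiberwise _ (fun g => μ (α g))]
    refine Finset.sum_congr rfl fun h _ => ?_
    rw [Finset.sum_smul]
    refine Finset.sum_congr rfl fun g hg => ?_
    rw [(Finset.mem_filter.mp hg).2]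
  obtain ⟨t, z, r, hl, hr, h⟩ := exists_compress_of_ofH (D := D) hc
  refine ⟨w ++ [x] ++ t, w ++ [x] ++ z, r, by simp [hl], hr, ?_⟩
  rw [← h, ← key, word_append _ (w ++ [x]), wordAdj_append _ (w ++ [x])]
  simp only [mul_assoc]

theorem exists_compress (hD : D.IsSeparating K) {a : NekrashevychAlgebra K D.group X}
    (ha : a ∈ D.nucleusSpan K 0) (ha0 : a ≠ 0) :
    ∃ (t z : List X) (r : K), t.length = z.length ∧ r ≠ 0 ∧
      wordAdj K t * a * word K z = algebraMap K _ r := by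
  classical
  obtain ⟨b, c, rfl⟩ := eq_sum_of_mem_nucleusSpan_zero K ha
  by_cases h : ∃ h ≠ 1, c h ≠ 0
  · obtain ⟨h, hh, hch⟩ := h
    exact exists_compress_of_ofH_ne_one b c hh hch
  push Not at h
  -- Both units give the same group element, so the remaining `H`-term is absorbed into the
  -- coefficient of `1` in `G`.
  have hsum : (∑ g, b g • grp K (D.ofG g) + ∑ h, c h • grp K (D.ofH h) :
      NekrashevychAlgebra K D.group X) = ∑ g, (b + Pi.single 1 (c 1) : G → K) g • grp K (D.ofG g) := by
    rw [Finset.sum_eq_single (s := Finset.univ (α := H)) 1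
      (fun k _ hk => by rw [h k hk, zero_smul]) (by simp)]
    simp [add_smul, Finset.sum_add_distrib, Pi.single_apply]
  rw [hsum] at ha0 ⊢
  exact exists_compress_of_ofG hD fun h0 => ha0 (by rw [h0]; simp)

variable (K) in
/-- The Nekrashevych algebra of a multispinal group is simple if the homomorphisms `μ ∘ α` separate
the elements of `K[G]`. -/
theorem isSimpleRing_of_isSeparating (hD : D.IsSeparating K) :
    IsSimpleRing (NekrashevychAlgebra K D.group X) := by
  have : Nontrivial X := D.nontrivial_letters
  refine IsSimpleRing.of_eq_bot_or_eq_top fun I => or_iff_not_imp_left.mpr fun hI => ?_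
  obtain ⟨f, hfI, hf⟩ : ∃ f ∈ I, f ≠ 0 := by
    by_contra! hcon
    exact hI (le_bot_iff.mp fun f hf => (TwoSidedIdeal.mem_bot _).mpr (hcon f hf))
  obtain ⟨v, L, hv0, hvL⟩ := exists_mul_word_mem_nucleusSpan K hf
  obtain ⟨a, ha, ha0, q, hq, haq⟩ := exists_add_mem_ideal K hvL hv0 (I.mul_mem_right _ _ hfI)
  obtain ⟨t, z, r, hl, hr, h⟩ := exists_compress hD ha ha0
  have h1 := I.mul_mem_right _ (word K z) (I.mul_mem_left (wordAdj K t) _ haq)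
  rw [mul_add, add_mul, h] at h1
  exact I.one_mem_iff.mp (one_mem_of_scalar_add_mem K hr (compress_mem_positivePart K hq hl) h1)

end MultispinalData

/-! ### Non-simplicity when the fibres of the `μ` have order zero in `K`. -/

namespace MultispinalData

open NekrashevychAlgebra Filter

variable {X G H : Type*} [Fintype X] [Group G] [Fintype G] [Group H] [Fintype H] [MulAction H X]
  {D : MultispinalData X G H} {K : Type*} [Field K]

open Classical in
-- Reading a letter with an automorphism only reparametrizes `G`; a letter with a homomorphism `μ`
-- turns the set into a union of fibres of `μ`, as does the empty word.
theorem card_ofG_smul_eq_zero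
    (hD : ∀ (x : X) (μ : G →* H), D.Φ x = .inr μ →
      ∀ h : H, (({g | μ g = h} : Finset G).card : K) = 0)
    (w w' : List X) : (({g | D.ofG g • w = w'} : Finset G).card : K) = 0 := by
  have sum_fibers : ∀ (x : X) (μ : G →* H), D.Φ x = .inr μ → ∀ s : Finset H,
      (({g | μ g ∈ s} : Finset G).card : K) = 0 := by
    intro x μ hx s
    rw [Finset.card_eq_sum_card_fiberwise (f := μ) (t := s) (fun g hg => by simpa using hg),
      Nat.cast_sum]
    refine Finset.sum_eq_zero fun h hh => ?_
    rw [← hD x μ hx h, Finset.filter_filter]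
    congr 2
    ext g
    simp only [Finset.mem_filter, Finset.mem_univ, true_and, and_iff_right_iff_imp]
    exact fun hg => hg ▸ hh
  induction w generalizing w' with
  | nil =>
    obtain ⟨x, μ, hx⟩ := D.s2
    by_cases h : w' = []
    · rw [← sum_fibers x μ hx Finset.univ, h]
      simp [smul_nil_word]
    · simp [smul_nil_word, Ne.symm h]
  | cons x w ih =>
    by_cases h : ∃ r, w' = x :: r
    · obtain ⟨r, rfl⟩ := h
      cases hx : D.Φ x with
      | inl α =>
        rw [← ih r]
        congr 1
        refine Finset.card_equiv α.toEquiv fun g => ?_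
        simp [ofG_smul_cons_of_inl hx]
      | inr μ =>
        rw [← sum_fibers x μ hx {h | D.ofH h • w = r}]
        simp [ofG_smul_cons_of_inr hx]
    · rw [Finset.filter_false_of_mem, Finset.card_empty, Nat.cast_zero]
      intro g _ hg
      exact h ⟨letterSection (D.ofG g) x • w, by rw [← hg, smul_cons_word, letterAct_ofG]⟩

theorem sum_ofG_ne_zero : ∑ g, grp K (D.ofG g) ≠ (0 : NekrashevychAlgebra K D.group X) := by
  classical
  intro h0
  obtain ⟨x, α, hx⟩ := D.s1
  -- Only the exponent `k` tends to infinity; the continuation `w` is unrestricted. An element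
  -- fixing the germ of `xᵏ w` must fix `xᵏ w` for some `k` and all `w`, which forces it to be 1.
  let l : Filter (ℕ × List X) := comap Prod.fst atTop
  have : l.NeBot := NeBot.comap_of_surj inferInstance Prod.fst_surjective
  let φ : RegularGerm X l := ⟨_, isRegularGerm_replicate_append x tendsto_comap fun ω => ω.2⟩
  have hφ : ∀ g : G, D.ofG g • φ = φ → g = 1 := by
    intro g hg
    by_contra hg1
    have h1 : ∀ᶠ ω in l, D.ofG g • (List.replicate ω.1 x ++ ω.2) = List.replicate ω.1 x ++ ω.2 :=
      Germ.coe_eq.mp (congrArg Subtype.val hg)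
    obtain ⟨k, hk⟩ := (eventually_comap.mp h1).exists
    have hrep : ∀ (k : ℕ) (g : G), ∃ g' : G, (g' = 1 → g = 1) ∧ ∀ w : List X,
        D.ofG g • (List.replicate k x ++ w) = List.replicate k x ++ D.ofG g' • w := by
      intro k
      induction k with
      | zero => exact fun g => ⟨g, id, fun w => rfl⟩
      | succ k ih =>
        intro g
        obtain ⟨g', h, h'⟩ := ih (α g)
        refine ⟨g', fun h1 => (MulEquiv.map_eq_one_iff α).mp (h h1), fun w => ?_⟩
        rw [List.replicate_succ, List.cons_append, ofG_smul_cons_of_inl hx, h']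
        rfl
    obtain ⟨g', h, h'⟩ := hrep k g
    obtain ⟨w, hw⟩ := exists_ofG_smul_ne (D := D) (g := g') fun h1 => hg1 (h h1)
    have h2 := hk (k, w) rfl
    rw [h', List.append_cancel_left_eq] at h2
    exact hw h2
  have h1 : germRep K l (∑ g, grp K (D.ofG g)) (Finsupp.single φ 1) φ = 1 := by
    rw [map_sum, LinearMap.sum_apply, Finsupp.finsetSum_apply, Finset.sum_eq_single 1]
    · rw [germRep_grp, map_one, one_smul, Finsupp.single_eq_same]
    · intro g _ hg
      rw [germRep_grp, Finsupp.single_apply, if_neg fun h => hg (hφ g h)]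
    · simp
  rw [h0, map_zero] at h1
  exact zero_ne_one h1

open Classical in
/-- The Nekrashevych algebra of a multispinal group is not simple if the orders of the fibres of
the homomorphisms among the `Φ(x)` vanish in the field. -/
theorem not_isSimpleRing_of_card_fiber_eq_zero
    (hD : ∀ (x : X) (μ : G →* H), D.Φ x = .inr μ →
      ∀ h : H, (({g | μ g = h} : Finset G).card : K) = 0) :
    ¬ IsSimpleRing (NekrashevychAlgebra K D.group X) := by
  intro hsimple
  have : Nontrivial X := D.nontrivial_letters
  let l : Filter ℕ := hyperfilter ℕ
  have : Nontrivial (RegularGerm X l →₀ K) :=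
    nontrivial_regularGerm_finsupp K (k := id) Nat.hyperfilter_le_atTop
  refine sum_ofG_ne_zero (D := D) (K := K)
    ((germRep (G := D.group) (X := X) K l).toRingHom.injective ?_)
  rw [map_zero]
  refine Finsupp.lhom_ext' fun φ => LinearMap.ext_ring (Finsupp.ext fun ψ => ?_)
  obtain ⟨φ, hφ⟩ := φ
  obtain ⟨ψ, hψ⟩ := ψ
  induction φ using Germ.inductionOn with
  | h f =>
  induction ψ using Germ.inductionOn with
  | h f' =>
  -- An ultrafilter decides each of the finitely many equations, so one index `n` reproduces all of
  -- them and the count on words applies to germs.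
  have hev : ∀ᶠ n in l, ∀ g : G, D.ofG g • f n = f' n ↔
      D.ofG g • (⟨f, hφ⟩ : RegularGerm X l) = ⟨f', hψ⟩ := by
    refine eventually_all.mpr fun g => ?_
    have h1 : D.ofG g • (⟨f, hφ⟩ : RegularGerm X l) = ⟨f', hψ⟩ ↔
        ∀ᶠ n in l, D.ofG g • f n = f' n :=
      Subtype.ext_iff.trans Germ.coe_eq
    by_cases h : ∀ᶠ n in l, D.ofG g • f n = f' n
    · exact h.mono fun n hn => iff_of_true hn (h1.mpr h)
    · exact (Ultrafilter.eventually_not.mpr h).mono fun n hn => iff_of_false hn (mt h1.mp h)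
  obtain ⟨n, hn⟩ := hev.exists
  change germRep K l (∑ g, grp K (D.ofG g)) (Finsupp.single _ 1) _ = 0
  rw [map_sum, LinearMap.sum_apply, Finsupp.finsetSum_apply,
    ← card_ofG_smul_eq_zero hD (f n) (f' n)]
  simp only [germRep_grp, Finsupp.single_apply, hn, Finset.sum_boole]

end MultispinalData

/-! ### The groups `𝔊ₙ`: fibre counts, Euclid's algorithm and Fourier inversion. -/

section SpinalGroups

open MultispinalData

theorem matAut_apply {n : ℕ} (M : Matrix.SpecialLinearGroup (Fin 2) (ZMod n))
    (g : Multiplicative (Fin 2 → ZMod n)) (i : Fin 2) :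
    (matAut M g).toAdd i = M.1 i 0 * g.toAdd 0 + M.1 i 1 * g.toAdd 1 := by
  change (M.1.mulVec g.toAdd) i = _
  simp [Matrix.mulVec, dotProduct, Fin.sum_univ_two]

theorem rowHom_apply {n : ℕ} (r : Fin 2 → ZMod n) (g : Multiplicative (Fin 2 → ZMod n)) :
    (rowHom r g).toAdd = r 0 * g.toAdd 0 + r 1 * g.toAdd 1 := by
  change r ⬝ᵥ g.toAdd = _
  simp [dotProduct, Fin.sum_univ_two]

theorem exists_eq_rowHom_of_spinalPhi_eq_inr {n : ℕ} {k : ZMod n}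
    {μ : Multiplicative (Fin 2 → ZMod n) →* Multiplicative (ZMod n)}
    (h : spinalPhi n k = .inr μ) : ∃ c : ZMod n, μ = rowHom ![0, c] := by
  unfold spinalPhi at h
  split_ifs at h
  · exact ⟨1, (Sum.inr.inj h).symm⟩
  · exact ⟨0, (Sum.inr.inj h).symm⟩

variable (n : ℕ) [Fact (2 < n)]

/-- The first coordinate is unconstrained and contributes a factor `n`. -/
theorem dvd_card_fiber_rowHom (c : ZMod n) (h : Multiplicative (ZMod n))
    (s : Finset (Multiplicative (Fin 2 → ZMod n))) (hs : ∀ g, g ∈ s ↔ rowHom ![0, c] g = h) :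
    n ∣ s.card := by
  have : s.card = (Finset.univ ×ˢ Finset.univ.filter fun b : ZMod n => c * b = h.toAdd :
      Finset (ZMod n × ZMod n)).card := by
    refine Finset.card_equiv (Multiplicative.toAdd.trans (finTwoArrowEquiv (ZMod n))) fun g => ?_
    rw [hs, ← Multiplicative.toAdd.injective.eq_iff, rowHom_apply]
    simp
  rw [this, Finset.card_product, Finset.card_univ, ZMod.card]
  exact dvd_mul_right _ _

theorem not_isSimpleRing_spinalGroup (K : Type*) [Field K] (hn : (n : K) = 0) :
    ¬ IsSimpleRing (NekrashevychAlgebra K (spinalGroup n) (ZMod n)) := by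
  classical
  refine not_isSimpleRing_of_card_fiber_eq_zero fun x μ hx h => ?_
  obtain ⟨c, rfl⟩ := exists_eq_rowHom_of_spinalPhi_eq_inr hx
  suffices key : ∀ s : Finset (Multiplicative (Fin 2 → ZMod n)),
      (∀ g, g ∈ s ↔ rowHom ![0, c] g = h) → (s.card : K) = 0 from
    key _ fun g => by simp
  intro s hs
  obtain ⟨k, hk⟩ := dvd_card_fiber_rowHom n c h s hs
  rw [hk, Nat.cast_mul, hn, zero_mul]

/-- Every row vector is a multiple of a row in the orbit of `(0 1)`. -/
theorem exists_row_eq_smul (s t : ZMod n) :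
    ∃ (d : ZMod n), ∃ α ∈ (spinalData n).autGroup, ∀ g : Multiplicative (Fin 2 → ZMod n),
      s * g.toAdd 0 + t * g.toAdd 1 = d * (α g).toAdd 1 := by
  have hn : 2 < n := Fact.out
  have : Fact (1 < n) := ⟨by omega⟩
  set p : ZMod n → ZMod n → Prop := fun s t =>
    ∃ (d : ZMod n), ∃ α ∈ (spinalData n).autGroup, ∀ g : Multiplicative (Fin 2 → ZMod n),
      s * g.toAdd 0 + t * g.toAdd 1 = d * (α g).toAdd 1
  obtain ⟨E, hE, hE0, hE1⟩ : ∃ E ∈ (spinalData n).autGroup,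
      (∀ g : Multiplicative (Fin 2 → ZMod n), (E g).toAdd 0 = g.toAdd 0 + g.toAdd 1) ∧
      ∀ g : Multiplicative (Fin 2 → ZMod n), (E g).toAdd 1 = g.toAdd 1 :=
    ⟨_, Subgroup.subset_closure ⟨0, if_pos rfl⟩,
      fun g => (matAut_apply ⟨!![1, 1; 0, 1], by simp [Matrix.det_fin_two]⟩ g 0).trans (by simp),
      fun g => (matAut_apply ⟨!![1, 1; 0, 1], by simp [Matrix.det_fin_two]⟩ g 1).trans (by simp)⟩
  obtain ⟨F, hF, hF0, hF1⟩ : ∃ F ∈ (spinalData n).autGroup,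
      (∀ g : Multiplicative (Fin 2 → ZMod n), (F g).toAdd 0 = g.toAdd 0) ∧
      ∀ g : Multiplicative (Fin 2 → ZMod n), (F g).toAdd 1 = g.toAdd 0 + g.toAdd 1 :=
    ⟨_, Subgroup.subset_closure ⟨1, (if_neg one_ne_zero).trans (if_pos rfl)⟩,
      fun g => (matAut_apply ⟨!![1, 0; 1, 1], by simp [Matrix.det_fin_two]⟩ g 0).trans (by simp),
      fun g => (matAut_apply ⟨!![1, 0; 1, 1], by simp [Matrix.det_fin_two]⟩ g 1).trans (by simp)⟩
  have base : ∀ t, p 0 t := fun t => ⟨t, 1, one_mem _, fun g => by simp⟩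
  have stepE : ∀ s t, p s t → p s (s + t) := by
    rintro s t ⟨d, α, hα, h⟩
    refine ⟨d, α * E, mul_mem hα hE, fun g => ?_⟩
    rw [MulAut.mul_apply, ← h, hE0, hE1]
    ring
  have stepE' : ∀ s t, p s (s + t) → p s t := by
    rintro s t ⟨d, α, hα, h⟩
    refine ⟨d, α * E⁻¹, mul_mem hα (inv_mem hE), fun g => ?_⟩
    obtain ⟨g, rfl⟩ := E.surjective g
    rw [MulAut.mul_apply, MulAut.inv_apply_self, ← h, hE0, hE1]
    ring
  have stepF : ∀ s t, p s t → p (s + t) t := by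
    rintro s t ⟨d, α, hα, h⟩
    refine ⟨d, α * F, mul_mem hα hF, fun g => ?_⟩
    rw [MulAut.mul_apply, ← h, hF0, hF1]
    ring
  -- Subtractive Euclidean algorithm on natural representatives, by induction on a bound for `s +
  -- t`.
  have main : ∀ N s t : ℕ, s + t ≤ N → p s t := by
    intro N
    induction N with
    | zero =>
      intro s t hst
      obtain rfl : s = 0 := by omega
      exact_mod_cast base t
    | succ N ih =>
      intro s t hst
      rcases Nat.eq_zero_or_pos s with rfl | hs
      · exact_mod_cast base t
      rcases Nat.eq_zero_or_pos t with rfl | ht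
      -- The row `(s, 0)` is reached as `(0, s) → (s, s) → (s, 0)`; here the inverse of `E` is
      -- needed.
      · have := stepF _ _ (base (s : ZMod n))
        rw [zero_add] at this
        refine stepE' _ _ ?_
        rwa [Nat.cast_zero, add_zero]
      rcases le_total s t with h | h
      · have := stepE _ _ (ih s (t - s) (by omega))
        rwa [← Nat.cast_add, Nat.add_sub_cancel' h] at this
      · have := stepF _ _ (ih (s - t) t (by omega))
        rwa [← Nat.cast_add, Nat.sub_add_cancel h] at this
  have := main _ s.val t.val le_rfl
  rwa [ZMod.natCast_zmod_val, ZMod.natCast_zmod_val] at this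

theorem isSeparating_spinalData (K : Type*) [Field K] (hn : (n : K) ≠ 0) :
    (spinalData n).IsSeparating K := by
  classical
  intro a ha
  obtain ⟨L, _, _, ψ, hψ⟩ : ∃ (L : Type _) (_ : Field L) (_ : Algebra K L)
      (ψ : AddChar (ZMod n) L), ψ.IsPrimitive :=
    let Ψ := AddChar.primitiveZModChar ⟨n, NeZero.pos n⟩ K hn
    ⟨_, inferInstance, inferInstance, Ψ.char, Ψ.prim⟩
  -- With `(s, t)` equal to `d` times the row `(0 1) α`, the character is constant on the fibres of
  -- `μ ∘ α`, and `a` sums to zero over each of them.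
  have hfourier : ∀ s t : ZMod n,
      ∑ g, algebraMap K L (a g) * ψ (s * g.toAdd 0 + t * g.toAdd 1) = 0 := by
    intro s t
    obtain ⟨d, α, hα, h⟩ := exists_row_eq_smul n s t
    rw [← Finset.sum_fiberwise _ (fun g => rowHom ![0, 1] (α g))]
    refine Finset.sum_eq_zero fun k _ => ?_
    have hk := ha (-1) _ (spinalPhi_neg_one n) α hα k
    rw [Finset.sum_congr (g := fun g => algebraMap K L (a g) * ψ (d * k.toAdd)) rfl,
      ← Finset.sum_mul, ← map_sum]
    · convert zero_mul _
      rw [← map_zero (algebraMap K L), ← hk]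
      congr!
    · intro g hg
      rw [h, ← (Finset.mem_filter.mp hg).2, rowHom_apply]
      simp
  funext v
  -- Fourier inversion at `v`, by orthogonality in each coordinate.
  have hsum : ∑ s : ZMod n, ∑ t : ZMod n, ψ (-(s * v.toAdd 0 + t * v.toAdd 1)) *
      ∑ g, algebraMap K L (a g) * ψ (s * g.toAdd 0 + t * g.toAdd 1) =
      (n : L) * n * algebraMap K L (a v) := by
    calc _ = ∑ g, algebraMap K L (a g) * ((∑ s : ZMod n, ψ (s * (g.toAdd 0 - v.toAdd 0))) *
          ∑ t : ZMod n, ψ (t * (g.toAdd 1 - v.toAdd 1))) := by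
          simp_rw [Finset.sum_mul_sum, Finset.mul_sum]
          rw [Finset.sum_comm (s := Finset.univ (α := Multiplicative (Fin 2 → ZMod n)))]
          refine Finset.sum_congr rfl fun s _ => ?_
          rw [Finset.sum_comm]
          refine Finset.sum_congr rfl fun g _ => Finset.sum_congr rfl fun t _ => ?_
          rw [mul_left_comm, ← AddChar.map_add_eq_mul, ← AddChar.map_add_eq_mul]
          congr 2
          ring
      _ = _ := by
          simp only [AddChar.sum_mulShift _ hψ, ZMod.card]
          rw [Finset.sum_eq_single v]
          · simp; ring
          · intro g _ hg
            by_cases h0 : g.toAdd 0 - v.toAdd 0 = 0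
            · by_cases h1 : g.toAdd 1 - v.toAdd 1 = 0
              · refine absurd (Multiplicative.toAdd.injective (funext fun i => ?_)) hg
                fin_cases i
                · exact sub_eq_zero.mp h0
                · exact sub_eq_zero.mp h1
              · simp [h1]
            · simp [h0]
          · simp
  simp only [hfourier, mul_zero, Finset.sum_const_zero] at hsum
  have hnL : (n : L) ≠ 0 := by
    rw [← map_natCast (algebraMap K L)]
    exact (map_ne_zero _).mpr hn
  have := (mul_eq_zero.mp hsum.symm).resolve_left (mul_ne_zero hnL hnL)
  exact (map_eq_zero _).mp this

theorem isSimpleRing_spinalGroup_iff (K : Type*) [Field K] (p : ℕ) [CharP K p] :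
    IsSimpleRing (NekrashevychAlgebra K (spinalGroup n) (ZMod n)) ↔ ¬ p ∣ n := by
  rw [← CharP.cast_eq_zero_iff K p n]
  exact ⟨fun h hn => not_isSimpleRing_spinalGroup n K hn h,
    fun hn => isSimpleRing_of_isSeparating K (isSeparating_spinalData n K hn)⟩

theorem exists_smul_eq_zmod {m : ℕ} (x y : ZMod m) : ∃ h : Multiplicative (ZMod m), h • x = y :=
  ⟨.ofAdd (y - x), sub_add_cancel y x⟩

theorem isSelfReplicating_spinalGroup : IsSelfReplicating (spinalGroup n) (ZMod n) :=
  isSelfReplicating exists_smul_eq_zmod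
    ⟨-1, _, spinalPhi_neg_one n, fun h => ⟨.ofAdd ![0, h.toAdd],
      Multiplicative.toAdd.injective (by rw [rowHom_apply]; simp)⟩⟩

end SpinalGroups

/-! ### An example that is simple over every field. -/

section Dihedral

open MultispinalData

/-- The multispinal data of the infinite dihedral group acting on the words over `ℤ/2`. -/
def dihedralData :
    MultispinalData (ZMod 2) (Multiplicative (ZMod 2)) (Multiplicative (ZMod 2)) where
  Φ k := if k = 0 then .inl 1 else .inr (MonoidHom.id _)
  free h x hx := by
    have : h.toAdd + x = x := hx
    exact Multiplicative.toAdd.injective (by simpa using this)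
  s1 := ⟨0, 1, if_pos rfl⟩
  s2 := ⟨1, MonoidHom.id _, if_neg one_ne_zero⟩
  s3 g hg := hg 1 (MonoidHom.id _) (if_neg one_ne_zero) 1 (one_mem _)

theorem dihedralData_phi_one : dihedralData.Φ 1 = .inr (MonoidHom.id _) := rfl

/-- The homomorphism at the letter 1 is the identity, so its fibres are single points and no
condition on the characteristic arises. -/
theorem isSeparating_dihedralData (K : Type*) [Field K] : dihedralData.IsSeparating K := by
  classical
  intro a ha
  funext g
  have := ha 1 _ dihedralData_phi_one 1 (one_mem _) g
  rw [Finset.sum_filter, Finset.sum_eq_single g] at this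
  · exact (if_pos rfl).symm.trans this
  · intro b _ hb
    exact if_neg hb
  · simp

theorem isSelfReplicating_dihedralData : IsSelfReplicating dihedralData.group (ZMod 2) :=
  isSelfReplicating exists_smul_eq_zmod
    ⟨1, _, dihedralData_phi_one, Function.surjective_id⟩

end Dihedral

theorem mainTheorem9 :
    (∀ (n : ℕ) [Fact (2 < n)] (K : Type u) [Field K] (p : ℕ) [CharP K p],
      IsSimpleRing (NekrashevychAlgebra K (spinalGroup n) (ZMod n)) ↔ ¬ p ∣ n) ∧
    (∀ P : Finset ℕ, (∀ p ∈ P, p.Prime) →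
      ∃ (X : Type) (_ : Fintype X) (_ : Nontrivial X) (G : Type) (_ : Group G)
        (_ : MulAction G (List X)) (_ : IsSelfSimilar G X),
        IsContracting G X ∧ IsSelfReplicating G X ∧
        ∀ (K : Type u) [Field K] (p : ℕ) [CharP K p],
          IsSimpleRing (NekrashevychAlgebra K G X) ↔ p ∉ P) := by
  refine ⟨fun n _ K _ p _ => isSimpleRing_spinalGroup_iff n K p, fun P hP => ?_⟩
  rcases P.eq_empty_or_nonempty with rfl | ⟨q, hq⟩
  · refine ⟨ZMod 2, inferInstance, inferInstance, dihedralData.group, inferInstance, inferInstance,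
      inferInstance, MultispinalData.isContracting, isSelfReplicating_dihedralData,
      fun K _ p _ => iff_of_true ?_ (Finset.notMem_empty p)⟩
    exact MultispinalData.isSimpleRing_of_isSeparating K (isSeparating_dihedralData K)
  · have hpos : 0 < ∏ p ∈ P, p := Finset.prod_pos fun p hp => (hP p hp).pos
    have hle : 2 ≤ ∏ p ∈ P, p :=
      (hP q hq).two_le.trans (Nat.le_of_dvd hpos (Finset.dvd_prod_of_mem _ hq))
    -- Squaring keeps the prime divisors and makes the number exceed 2 even for `P = {2}`.
    have : Fact (2 < (∏ p ∈ P, p) ^ 2) := ⟨by nlinarith⟩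
    have : Fact (1 < (∏ p ∈ P, p) ^ 2) := ⟨by nlinarith⟩
    refine ⟨ZMod ((∏ p ∈ P, p) ^ 2), inferInstance, inferInstance, spinalGroup _, inferInstance,
      inferInstance, inferInstance, MultispinalData.isContracting,
      isSelfReplicating_spinalGroup _, fun K _ p _ => ?_⟩
    rw [isSimpleRing_spinalGroup_iff _ K p, not_iff_not]
    refine ⟨fun h => ?_, fun h => (Finset.dvd_prod_of_mem _ h).trans (dvd_pow_self _ two_ne_zero)⟩
    obtain hp | rfl := CharP.char_is_prime_or_zero K p
    · obtain ⟨r, hr, hpr⟩ := (hp.prime.dvd_finsetProd_iff _).mp (hp.dvd_of_dvd_pow h)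
      rwa [(Nat.prime_dvd_prime_iff_eq hp (hP r hr)).mp hpr]
    · exact absurd (zero_dvd_iff.mp h) (pow_ne_zero 2 hpos.ne')
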